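/- Let $X$ be a real Banach space with closed unit ball $B_X$ and unit sphere $S_X$. Assume that $X$ is $\omega$-LUR, that is, for every $x\in S_X$ and every sequence $(x_n)\subset B_X$ with $\|x+x_n\|\to 2$, the sequence $(x_n)$ converges weakly to $x$. Assume moreover that: (i) there exists a big point $u\in S_X$, that is, a point $u \in S_X$ such that $\overline{\mathrm{conv}}\{T(u) : T\in\mathcal{G}_X\}=B_X$, where $\mathcal{G}_X$ is the group of linear isometries of $X$ onto $X$; (ii) for each $\varepsilon>0$ there exists a $1$-codimensional, $(1+\varepsilon)$-complemented subspace $Z_\varepsilon\subset X$, that is, a linear subspace $Z_\varepsilon$ with $\dim(X/Z_\varepsilon)=1$ that is the range of a bounded linear projection $P\colon X\to Z_\varepsilon$ with $\|P\|\le 1+\varepsilon$. Then $X$ is isometrically a Hilbert space, that is, there is a linear isometry from $X$ onto a real Hilbert space. -/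

import Mathlib

open Filter Topology

/-- A point `x` of the unit sphere is `ω`-LUR (weakly locally uniformly rotund) if every sequence
in the closed unit ball with `‖x + xₙ‖ → 2` converges to `x` in the weak topology. -/
def IsWeaklyLURPoint {X : Type*} [NormedAddCommGroup X] [NormedSpace ℝ X] (x : X) : Prop :=
  ‖x‖ = 1 ∧ ∀ y : ℕ → X, (∀ n, ‖y n‖ ≤ 1) →
    Tendsto (fun n => ‖x + y n‖) atTop (𝓝 2) →
    Tendsto (fun n => toWeakSpace ℝ X (y n)) atTop (𝓝 (toWeakSpace ℝ X x))

/-- A space is `ω`-LUR if each point of its unit sphere is an `ω`-LUR point. -/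
def IsWeaklyLUR (X : Type*) [NormedAddCommGroup X] [NormedSpace ℝ X] : Prop :=
  ∀ x : X, ‖x‖ = 1 → IsWeaklyLURPoint x

/-- The orbit of `x` under the group of rotations (linear isometries of `X` onto itself). -/
def rotationOrbit {X : Type*} [NormedAddCommGroup X] [NormedSpace ℝ X] (x : X) : Set X :=
  {y | ∃ T : X ≃ₗᵢ[ℝ] X, T x = y}

/-- A point of the unit sphere is big if the closed convex hull of its orbit under rotations
is the closed unit ball. -/
def IsBigPoint {X : Type*} [NormedAddCommGroup X] [NormedSpace ℝ X] (x : X) : Prop :=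
  ‖x‖ = 1 ∧ closure (convexHull ℝ (rotationOrbit x)) = Metric.closedBall (0 : X) 1

/-- A subspace `Z` is `C`-complemented if it is the range of a bounded linear projection of norm
at most `C`. Such a `Z` is automatically closed. -/
def IsComplementedWithConst {X : Type*} [NormedAddCommGroup X] [NormedSpace ℝ X]
    (C : ℝ) (Z : Submodule ℝ X) : Prop :=
  ∃ P : X →L[ℝ] X, (∀ x, P x ∈ Z) ∧ (∀ z ∈ Z, P z = z) ∧ ‖P‖ ≤ C

/-- A real normed space is isometrically a Hilbert space if there is a linear isometry
from it onto a real Hilbert space. -/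
def IsIsometricallyHilbert.{u} (X : Type u) [NormedAddCommGroup X] [NormedSpace ℝ X] : Prop :=
  ∃ (H : Type u) (_ : NormedAddCommGroup H) (_ : InnerProductSpace ℝ H) (_ : CompleteSpace H),
    Nonempty (X ≃ₗᵢ[ℝ] H)

/-! ### Weak rotundity, big points, and norm-one projections along every line -/

section WeakRotundity

variable {X : Type*} [NormedAddCommGroup X] [NormedSpace ℝ X]

/-! Rotations are weakly almost transitive on the sphere: for unit vectors `e`, `x` some rotations
`T n` give `‖x + T n e‖ → 2`, and ω-LUR turns this into weak convergence both of `T n e` to `x` and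
of the inverse images of `x` to `e`. Transporting the almost contractive projections `y ↦ y - k y •
e` by such rotations and taking a weak* limit, every nonzero `x` acquires a contractive projection
along `x` (`IsWeaklyLUR.exists_isPolar`).

In a three-dimensional subspace this forces a Euclidean norm, in the manner of Blaschke and
Kakutani. By rotundity the functional `K x` of that projection is unique and continuous in `x`.
Projectively, `K` sends lines into pencils and is injective, so it is a continuous collineation onto
its image and hence linear. In an Auerbach basis it is diagonal, and `K x x = 1` makes the diagonal
positive, so `K` is orthogonality for an inner product. Euclidean orthogonal projections onto lines
then contract the norm, which makes it constant on the Euclidean sphere.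

If there is no room for a third dimension, a plane is treated separately: a quadratic form of
maximal determinant below the squared norm is invariant under rotations, hence constant on the unit
sphere. The parallelogram law follows in all cases, and Jordan and von Neumann conclude. -/

theorem tendsto_apply_of_tendsto_toWeakSpace {y : ℕ → X} {x : X}
    (h : Tendsto (fun n => toWeakSpace ℝ X (y n)) atTop (𝓝 (toWeakSpace ℝ X x)))
    (f : X →L[ℝ] ℝ) : Tendsto (fun n => f (y n)) atTop (𝓝 (f x)) := by
  have := (WeakBilin.eval_continuous (topDualPairing ℝ X).flip f).tendsto (toWeakSpace ℝ X x)
  exact this.comp h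

theorem IsWeaklyLUR.tendsto_apply (hX : IsWeaklyLUR X) {x : X} (hx : ‖x‖ = 1) {y : ℕ → X}
    (hy : ∀ n, ‖y n‖ ≤ 1) (h : Tendsto (fun n => ‖x + y n‖) atTop (𝓝 2)) (f : X →L[ℝ] ℝ) :
    Tendsto (fun n => f (y n)) atTop (𝓝 (f x)) :=
  tendsto_apply_of_tendsto_toWeakSpace ((hX x hx).2 y hy h) f

/-- Two points of the unit sphere at which the triangle inequality is an equality coincide. -/
def IsRotund (X : Type*) [NormedAddCommGroup X] [NormedSpace ℝ X] : Prop :=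
  ∀ x y : X, ‖x‖ = 1 → ‖y‖ = 1 → 2 ≤ ‖x + y‖ → x = y

theorem IsWeaklyLUR.isRotund (hX : IsWeaklyLUR X) : IsRotund X := by
  intro x y hx hy hxy
  have h2 : ‖x + y‖ = 2 := le_antisymm ((norm_add_le x y).trans (by linarith)) hxy
  have h := fun f : X →L[ℝ] ℝ => hX.tendsto_apply hx (y := fun _ => y) (fun _ => hy.le)
    (by simp [h2]) f
  by_contra hne
  obtain ⟨f, -, hf⟩ := exists_dual_vector ℝ (x - y) (by simpa [sub_eq_zero] using hne)
  have := tendsto_nhds_unique (h f) tendsto_const_nhds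
  rw [map_sub, this, sub_self] at hf
  exact hne (sub_eq_zero.1 (norm_eq_zero.1 (by simpa using hf.symm)))

theorem exists_norming {x : X} (hx : ‖x‖ = 1) :
    ∃ f : X →L[ℝ] ℝ, f x = 1 ∧ ∀ y, |f y| ≤ ‖y‖ := by
  obtain ⟨f, hf, hfx⟩ := exists_dual_vector ℝ x (by simp [hx])
  refine ⟨f, by simpa [hx] using hfx, fun y => ?_⟩
  have := f.le_opNorm y
  rwa [hf, one_mul, Real.norm_eq_abs] at this

theorem tendsto_norm_add_of_apply {x : X} (hx : ‖x‖ = 1) {f : X →L[ℝ] ℝ} (hfx : f x = 1)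
    (hf : ∀ y, |f y| ≤ ‖y‖) {y : ℕ → X} (hy : ∀ n, ‖y n‖ ≤ 1)
    (h : ∀ n : ℕ, 1 - 1 / ((n : ℝ) + 1) < f (y n)) :
    Tendsto (fun n => ‖x + y n‖) atTop (𝓝 2) := by
  have h0 : Tendsto (fun n : ℕ => 2 - 1 / ((n : ℝ) + 1)) atTop (𝓝 2) := by
    simpa using (tendsto_const_nhds (x := (2 : ℝ))).sub
      (tendsto_one_div_add_atTop_nhds_zero_nat (𝕜 := ℝ))
  refine tendsto_of_tendsto_of_tendsto_of_le_of_le h0 tendsto_const_nhds (fun n => ?_)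
    (fun n => ?_)
  · have h1 := (le_abs_self _).trans (hf (x + y n))
    rw [map_add, hfx] at h1
    have := h n
    dsimp only
    linarith
  · exact (norm_add_le x (y n)).trans (by linarith [hy n])

theorem IsBigPoint.exists_lt_apply {u : X} (hu : IsBigPoint u) {x : X} (hx : ‖x‖ = 1)
    {f : X →L[ℝ] ℝ} (hfx : f x = 1) {δ : ℝ} (hδ : 0 < δ) :
    ∃ T : X ≃ₗᵢ[ℝ] X, 1 - δ < f (T u) := by
  by_contra! hcon
  have hsub : closure (convexHull ℝ (rotationOrbit u)) ⊆ {y | f y ≤ 1 - δ} := by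
    refine closure_minimal (convexHull_min ?_ ?_) ?_
    · rintro _ ⟨T, rfl⟩
      exact hcon T
    · exact convex_halfSpace_le f.toLinearMap.isLinear _
    · exact isClosed_le f.continuous continuous_const
  rw [hu.2] at hsub
  have : f x ≤ 1 - δ := hsub (by simp [hx])
  linarith

/-- In a weakly locally uniformly rotund space with a big point, all points of the unit sphere
are big, as far as norm-attaining functionals can tell. -/
theorem IsWeaklyLUR.exists_rotation_lt_apply (hX : IsWeaklyLUR X) {u : X} (hu : IsBigPoint u)
    {e x : X} (he : ‖e‖ = 1) (hx : ‖x‖ = 1) {f : X →L[ℝ] ℝ} (hfx : f x = 1)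
    {δ : ℝ} (hδ : 0 < δ) :
    ∃ T : X ≃ₗᵢ[ℝ] X, 1 - δ < f (T e) := by
  obtain ⟨S, hS⟩ := hu.exists_lt_apply hx hfx hδ
  obtain ⟨g, hge, hg⟩ := exists_norming he
  choose T hT using fun n : ℕ => hu.exists_lt_apply he hge (δ := 1 / ((n : ℝ) + 1)) (by positivity)
  have h1 := tendsto_norm_add_of_apply he hge hg (y := fun n => T n u)
    (fun n => by simp [hu.1]) hT
  -- Rotating back moves the limit point from `e` to `u`; rotundity at `u` then sends `(T n).symm e`
  -- weakly to `u`, and `S` carries this near the maximum of `f`.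
  have h2 : Tendsto (fun n => ‖u + (T n).symm e‖) atTop (𝓝 2) := by
    refine h1.congr fun n => ?_
    rw [← (T n).norm_map (u + (T n).symm e)]
    simp [add_comm]
  have h3 := hX.tendsto_apply hu.1 (fun n => by simp [he]) h2
    (f.comp (S.toContinuousLinearEquiv : X →L[ℝ] X))
  obtain ⟨n, hn⟩ := (h3.eventually (lt_mem_nhds (a := 1 - δ) (by simpa using hS))).exists
  exact ⟨(T n).symm.trans S, by simpa using hn⟩

/-- For unit vectors `e` and `x` some sequence of rotations takes `e` weakly to `x`, while the
inverse rotations take `x` weakly to `e`. -/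
theorem IsWeaklyLUR.exists_rotations (hX : IsWeaklyLUR X) {u : X} (hu : IsBigPoint u)
    {e x : X} (he : ‖e‖ = 1) (hx : ‖x‖ = 1) :
    ∃ T : ℕ → X ≃ₗᵢ[ℝ] X, Tendsto (fun n => ‖x + T n e‖) atTop (𝓝 2) ∧
      ∀ f : X →L[ℝ] ℝ, Tendsto (fun n => f ((T n).symm x)) atTop (𝓝 (f e)) := by
  obtain ⟨g, hgx, hg⟩ := exists_norming hx
  choose T hT using fun n : ℕ =>
    hX.exists_rotation_lt_apply hu he hx hgx (δ := 1 / ((n : ℝ) + 1)) (by positivity)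
  have h1 := tendsto_norm_add_of_apply hx hgx hg (y := fun n => T n e)
    (fun n => by simp [he]) hT
  refine ⟨T, h1, fun f => hX.tendsto_apply he (fun n => by simp [hx]) (h1.congr fun n => ?_) f⟩
  rw [← (T n).norm_map (e + (T n).symm x)]
  simp [add_comm]

/-- The kernel of the projection is a line. With `e` a unit vector on it, the complementary
projection is `k(·) e`. -/
theorem exists_rank_one_of_complemented {Z : Submodule ℝ X}
    (hZ : Module.finrank ℝ (X ⧸ Z) = 1) {C : ℝ} (hC : IsComplementedWithConst C Z) :
    ∃ (e : X) (k : X →L[ℝ] ℝ), ‖e‖ = 1 ∧ k e = 1 ∧ ∀ y, ‖y - k y • e‖ ≤ C * ‖y‖ := by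
  obtain ⟨P, hPZ, hP, hPC⟩ := hC
  obtain ⟨q, hq, hqs⟩ := finrank_eq_one_iff'.1 hZ
  obtain ⟨v, rfl⟩ := Z.mkQ_surjective q
  have hv : v ∉ Z := by simpa using hq
  set e₀ := v - P v with he₀
  have he₀0 : e₀ ≠ 0 := by
    intro h
    exact hv (sub_eq_zero.1 h ▸ hPZ v)
  have hPe₀ : P e₀ = 0 := by rw [he₀, map_sub, hP _ (hPZ v), sub_self]
  have key : ∀ y, ∃ c : ℝ, y - P y = c • e₀ := by
    intro y
    obtain ⟨c, hc⟩ := hqs (Z.mkQ y)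
    have hmem : y - c • v ∈ Z := by
      rw [← Submodule.Quotient.mk_eq_zero, Submodule.Quotient.mk_sub, sub_eq_zero]
      simpa using hc.symm
    have := hP _ hmem
    refine ⟨c, ?_⟩
    rw [map_sub, map_smul] at this
    rw [he₀, smul_sub, sub_eq_sub_iff_add_eq_add]
    have h2 : P y = y - c • v + c • P v := by rw [← this]; abel
    rw [h2]; abel
  have hn0 : ‖e₀‖ ≠ 0 := norm_ne_zero_iff.2 he₀0
  set e := ‖e₀‖⁻¹ • e₀ with he
  have hen : ‖e‖ = 1 := by rw [he, norm_smul, norm_inv, norm_norm, inv_mul_cancel₀ hn0]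
  obtain ⟨φ, hφ, -⟩ := exists_norming hen
  have hk : ∀ y, φ (y - P y) • e = y - P y := by
    intro y
    obtain ⟨c, hc⟩ := key y
    have : y - P y = (c * ‖e₀‖) • e := by
      rw [hc, he, smul_smul, mul_assoc, mul_inv_cancel₀ hn0, mul_one]
    rw [this, map_smul, hφ, smul_eq_mul, mul_one]
  refine ⟨e, φ.comp (ContinuousLinearMap.id ℝ X - P), hen, ?_, fun y => ?_⟩
  · have : P e = 0 := by rw [he, map_smul, hPe₀, smul_zero]
    simp [this, hφ]
  · have : y - (φ.comp (ContinuousLinearMap.id ℝ X - P)) y • e = P y := by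
      have := hk y
      simp only [ContinuousLinearMap.comp_apply, sub_apply,
        ContinuousLinearMap.id_apply]
      rw [this]; abel
    rw [this]
    exact (P.le_opNorm y).trans (by gcongr)

/-- `k` defines a contractive projection along `x` onto its kernel. -/
def IsPolar (x : X) (k : X →L[ℝ] ℝ) : Prop :=
  k x = 1 ∧ ∀ y, ‖y - k y • x‖ ≤ ‖y‖

/-- The condition on `k x` cannot be replaced by `k e = 1`: both `e` and `k` converge only weakly,
so the pairing `k e` need not pass to the limit. -/
theorem exists_isPolar_of_approx (hX : IsWeaklyLUR X) {x : X} (hx : ‖x‖ = 1)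
    (h : ∀ δ : ℝ, 0 < δ → ∃ (e : X) (k : X →L[ℝ] ℝ), ‖e‖ = 1 ∧ 2 - δ < ‖x + e‖ ∧ |k x - 1| < δ ∧
      ∀ y, ‖y - k y • e‖ ≤ (1 + δ) * ‖y‖) :
    ∃ k : X →L[ℝ] ℝ, IsPolar x k := by
  choose e k he hxe hkx hk using fun n : ℕ => h (1 / ((n : ℝ) + 1)) (by positivity)
  have hδ := tendsto_one_div_add_atTop_nhds_zero_nat (𝕜 := ℝ)
  have hδ1 : ∀ n : ℕ, 1 / ((n : ℝ) + 1) ≤ 1 := fun n => by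
    rw [div_le_one (by positivity)]; linarith [n.cast_nonneg (α := ℝ)]
  have h2 : Tendsto (fun n => ‖x + e n‖) atTop (𝓝 2) := by
    have h0 : Tendsto (fun n : ℕ => 2 - 1 / ((n : ℝ) + 1)) atTop (𝓝 2) := by
      simpa using (tendsto_const_nhds (x := (2 : ℝ))).sub hδ
    refine tendsto_of_tendsto_of_tendsto_of_le_of_le h0 tendsto_const_nhds
      (fun n => (hxe n).le) (fun n => ?_)
    exact (norm_add_le x (e n)).trans (by linarith [he n])
  have hw := hX.tendsto_apply hx (fun n => (he n).le) h2
  -- Since `e n` is a unit vector, `|k n y| ≤ ‖y‖ + (1 + δ)‖y‖`, and `δ ≤ 1`.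
  have hkb : ∀ n y, |k n y| ≤ 3 * ‖y‖ := by
    intro n y
    have h3 : ‖k n y • e n‖ ≤ 3 * ‖y‖ := by
      have := norm_sub_le y (y - k n y • e n)
      rw [sub_sub_cancel] at this
      nlinarith [hk n y, hδ1 n, norm_nonneg y]
    rwa [norm_smul, he n, mul_one, Real.norm_eq_abs] at h3
  have hle : ((hyperfilter ℕ : Ultrafilter ℕ) : Filter ℕ) ≤ atTop := Nat.hyperfilter_le_atTop
  have hcomp := WeakDual.isCompact_closedBall (𝕜 := ℝ) (E := X) 0 3
  obtain ⟨k₀, -, hk₀⟩ := hcomp.ultrafilter_le_nhds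
    ((hyperfilter ℕ).map fun n => StrongDual.toWeakDual (k n)) (by
      rw [le_principal_iff]
      refine Ultrafilter.mem_map.2 (Filter.univ_mem' fun n => ?_)
      simp only [Set.mem_preimage, Metric.mem_closedBall, dist_zero_right]
      exact (k n).opNorm_le_bound (by norm_num) (hkb n))
  have hlim : ∀ y, Tendsto (fun n => k n y) (hyperfilter ℕ) (𝓝 (k₀ y)) := fun y =>
    ((WeakDual.eval_continuous y).tendsto k₀).comp hk₀
  refine ⟨WeakDual.toStrongDual k₀, ?_, fun y => ?_⟩
  · refine tendsto_nhds_unique (hlim x) (Tendsto.mono_left ?_ hle)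
    rw [tendsto_iff_norm_sub_tendsto_zero]
    exact squeeze_zero (fun n => norm_nonneg _) (fun n => (hkx n).le) hδ
  -- As `e n` converges only weakly, the norm bound is tested on each functional `φ` before passing
  -- to the limit.
  · refine NormedSpace.norm_le_dual_bound ℝ _ (norm_nonneg _) fun φ => ?_
    have l1 : Tendsto (fun n => |φ y - k n y * φ (e n)|) (hyperfilter ℕ)
        (𝓝 |φ y - k₀ y * φ x|) :=
      (tendsto_const_nhds.sub ((hlim y).mul ((hw φ).mono_left hle))).abs
    have l2 : Tendsto (fun n : ℕ => ‖φ‖ * ((1 + 1 / ((n : ℝ) + 1)) * ‖y‖)) (hyperfilter ℕ)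
        (𝓝 (‖φ‖ * ((1 + 0) * ‖y‖))) :=
      (((tendsto_const_nhds.add hδ).mul_const _).const_mul _).mono_left hle
    have := le_of_tendsto_of_tendsto' l1 l2 fun n => by
      have h4 := (φ.le_opNorm (y - k n y • e n)).trans
        (mul_le_mul_of_nonneg_left (hk n y) (norm_nonneg φ))
      simpa using h4
    have h5 : φ (y - WeakDual.toStrongDual k₀ y • x) = φ y - k₀ y * φ x := by
      rw [map_sub, map_smul]; rfl
    rw [h5, Real.norm_eq_abs]
    linarith

theorem IsPolar.inv_smul {x : X} {k : X →L[ℝ] ℝ} (h : IsPolar x k) {c : ℝ} (hc : c ≠ 0) :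
    IsPolar (c • x) (c⁻¹ • k) := by
  refine ⟨by simp [h.1, hc], fun y => ?_⟩
  have : (c⁻¹ • k) y • c • x = k y • x := by
    rw [smul_smul, smul_apply, smul_eq_mul]
    congr 1; field_simp
  rw [this]
  exact h.2 y

theorem IsWeaklyLUR.exists_isPolar (hX : IsWeaklyLUR X) (hbig : ∃ u : X, IsBigPoint u)
    (hcompl : ∀ ε : ℝ, 0 < ε → ∃ Z : Submodule ℝ X,
      Module.finrank ℝ (X ⧸ Z) = 1 ∧ IsComplementedWithConst (1 + ε) Z) {x : X} (hx : x ≠ 0) :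
    ∃ k : X →L[ℝ] ℝ, IsPolar x k := by
  obtain ⟨u, hu⟩ := hbig
  have hx0 : ‖x‖ ≠ 0 := norm_ne_zero_iff.2 hx
  suffices H : ∃ k : X →L[ℝ] ℝ, IsPolar (‖x‖⁻¹ • x) k by
    obtain ⟨k, hk⟩ := H
    have := hk.inv_smul hx0
    rw [smul_smul, mul_inv_cancel₀ hx0, one_smul] at this
    exact ⟨_, this⟩
  have hx1 : ‖‖x‖⁻¹ • x‖ = 1 := by rw [norm_smul, norm_inv, norm_norm, inv_mul_cancel₀ hx0]
  generalize ‖x‖⁻¹ • x = x at hx1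
  refine exists_isPolar_of_approx hX hx1 fun δ hδ => ?_
  obtain ⟨Z, hZ, hC⟩ := hcompl δ hδ
  obtain ⟨e, k, he, hke, hk⟩ := exists_rank_one_of_complemented hZ hC
  obtain ⟨T, hT, hT'⟩ := hX.exists_rotations hu he hx1
  have ev1 := hT.eventually (lt_mem_nhds (a := 2 - δ) (by linarith))
  have ev2 := (hT' k).eventually (Metric.ball_mem_nhds _ hδ)
  obtain ⟨n, hn1, hn2⟩ := (ev1.and ev2).exists
  refine ⟨T n e, k.comp ((T n).symm.toContinuousLinearEquiv : X →L[ℝ] X), by simp [he], hn1, ?_,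
    fun y => ?_⟩
  · rw [Real.dist_eq, hke] at hn2
    exact hn2
  · have := hk ((T n).symm y)
    rw [← (T n).norm_map, LinearIsometryEquiv.norm_map (T n).symm] at this
    simpa using this

end WeakRotundity

/-! ### Polar functionals of a rotund space; the collineation they define in dimension three -/

section Polar

variable {V : Type*} [NormedAddCommGroup V] [NormedSpace ℝ V]

theorem IsRotund.eq_of_norm_le (hV : IsRotund V) {p q : V} {r : ℝ} (hp : ‖p‖ ≤ r) (hq : ‖q‖ ≤ r)
    (h : 2 * r ≤ ‖p + q‖) : p = q := by
  have htri := norm_add_le p q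
  have hp' : ‖p‖ = r := by linarith
  have hq' : ‖q‖ = r := by linarith
  rcases eq_or_ne r 0 with rfl | hr
  · rw [norm_eq_zero.1 hp', norm_eq_zero.1 hq']
  have hr0 : 0 < r := lt_of_le_of_ne (hp' ▸ norm_nonneg p) hr.symm
  have hs : ∀ v : V, ‖r⁻¹ • v‖ = r⁻¹ * ‖v‖ := fun v => by
    rw [norm_smul, Real.norm_eq_abs, abs_of_pos (inv_pos.2 hr0)]
  have := hV (r⁻¹ • p) (r⁻¹ • q) (by rw [hs, hp', inv_mul_cancel₀ hr])
    (by rw [hs, hq', inv_mul_cancel₀ hr]) (by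
      rw [← smul_add, hs, inv_mul_eq_div, le_div_iff₀ hr0]; exact h)
  exact smul_right_injective V (inv_ne_zero hr) this

theorem IsPolar.ne_zero {x : V} {k : V →L[ℝ] ℝ} (h : IsPolar x k) : x ≠ 0 := by
  rintro rfl
  simpa using h.1

/-- Shift `z` along `x` so that the two projections move it by opposite amounts. The images have
norm at most `‖z'‖` and midpoint `z'`, so rotundity identifies them. -/
theorem IsPolar.unique (hV : IsRotund V) {x : V} {k k' : V →L[ℝ] ℝ} (h : IsPolar x k)
    (h' : IsPolar x k') : k = k' := by
  ext z
  set z' := z - ((k z + k' z) / 2) • x with hz'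
  have e1 : k z' = (k z - k' z) / 2 := by rw [hz', map_sub, map_smul, h.1, smul_eq_mul]; ring
  have e2 : k' z' = -((k z - k' z) / 2) := by rw [hz', map_sub, map_smul, h'.1, smul_eq_mul]; ring
  have b1 := h.2 z'
  have b2 := h'.2 z'
  rw [e1] at b1
  rw [e2] at b2
  have := hV.eq_of_norm_le b1 b2 (by
    have : z' - ((k z - k' z) / 2) • x + (z' - -((k z - k' z) / 2) • x) = (2 : ℝ) • z' := by
      module
    rw [this, norm_smul]; simp)
  have h0 : (k z - k' z) • x = 0 := by
    have h1 := sub_eq_zero.2 this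
    rw [← neg_eq_zero, ← h1]; module
  exact sub_eq_zero.1 ((smul_eq_zero.1 h0).resolve_right h.ne_zero)

/-- The projection keeps the value `f z = ‖z‖` and does not increase the norm, so by rotundity it
fixes `z`. -/
theorem IsPolar.apply_eq_zero (hV : IsRotund V) {x z : V} {k f : V →L[ℝ] ℝ} (h : IsPolar x k)
    (hf : ∀ w, |f w| ≤ ‖w‖) (hfz : f z = ‖z‖) (hfx : f x = 0) : k z = 0 := by
  have := hV.eq_of_norm_le le_rfl (h.2 z) (by
    have h1 := (le_abs_self _).trans (hf (z + (z - k z • x)))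
    rw [map_add, map_sub, map_smul, hfx, hfz, smul_zero, sub_zero] at h1
    linarith)
  have h0 : k z • x = 0 := by
    have h1 := sub_eq_zero.2 this
    rwa [sub_sub_cancel] at h1
  exact (smul_eq_zero.1 h0).resolve_right h.ne_zero

/-- Compose a norming functional of `z` with the contractive projection along `x`. -/
theorem IsPolar.exists_norming {x z : V} {k : V →L[ℝ] ℝ} (h : IsPolar x k) (hz : k z = 0)
    (hz0 : z ≠ 0) :
    ∃ f : V →L[ℝ] ℝ, f x = 0 ∧ f z = ‖z‖ ∧ ∀ w, |f w| ≤ ‖w‖ := by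
  obtain ⟨φ, hφ, hφz⟩ := exists_dual_vector ℝ z (norm_ne_zero_iff.2 hz0)
  refine ⟨φ - φ x • k, by simp [h.1], by simpa [hz] using hφz, fun w => ?_⟩
  have h1 := φ.le_opNorm (w - k w • x)
  rw [hφ, one_mul] at h1
  have h2 : (φ - φ x • k) w = φ (w - k w • x) := by
    simp [mul_comm]
  rw [h2]
  exact h1.trans (h.2 w)

/-- `K` assigns to each nonzero vector the functional of its contractive projection. -/
def IsPolarField (K : V → V →L[ℝ] ℝ) : Prop := ∀ x, x ≠ 0 → IsPolar x (K x)

variable {K : V → V →L[ℝ] ℝ}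

theorem IsPolarField.smul (hV : IsRotund V) (hK : IsPolarField K) {x : V} (hx : x ≠ 0) {c : ℝ}
    (hc : c ≠ 0) : K (c • x) = c⁻¹ • K x :=
  (hK _ (smul_ne_zero hc hx)).unique hV ((hK x hx).inv_smul hc)

/-- Near `x` the functionals `K v` are bounded, so they have weak* limits along ultrafilters; each
limit is polar at `x` and equals `K x` by uniqueness. -/
theorem IsPolarField.continuousAt (hV : IsRotund V) (hK : IsPolarField K) {x : V} (hx : x ≠ 0)
    (y : V) : ContinuousAt (fun v => K v y) x := by
  refine tendsto_iff_ultrafilter _ _ _ |>.2 fun G hG => ?_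
  have hx0 : 0 < ‖x‖ := norm_pos_iff.2 hx
  have hev : ∀ᶠ v in (G : Filter V), ‖x‖ / 2 < ‖v‖ :=
    hG ((continuous_norm.tendsto x).eventually (lt_mem_nhds (by linarith)))
  have hcomp := WeakDual.isCompact_closedBall (𝕜 := ℝ) (E := V) 0 (4 / ‖x‖)
  obtain ⟨k, -, hk⟩ := hcomp.ultrafilter_le_nhds (G.map fun v => StrongDual.toWeakDual (K v)) (by
    rw [le_principal_iff]
    refine Ultrafilter.mem_map.2 ?_
    filter_upwards [hev] with v hv
    simp only [Set.mem_preimage, Metric.mem_closedBall, dist_zero_right]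
    have hv0 : v ≠ 0 := norm_pos_iff.1 (by linarith)
    refine (K v).opNorm_le_bound (by positivity) fun w => ?_
    have h1 := norm_sub_le w (w - K v w • v)
    rw [sub_sub_cancel, norm_smul] at h1
    have h2 := (hK v hv0).2 w
    have h3 : ‖K v w‖ * (‖x‖ / 2) ≤ ‖K v w‖ * ‖v‖ := by gcongr
    rw [div_mul_eq_mul_div, le_div_iff₀ hx0]
    linarith)
  have hlim : ∀ w, Tendsto (fun v => K v w) G (𝓝 (k w)) := fun w =>
    ((WeakDual.eval_continuous w).tendsto k).comp hk
  have hb : ∀ w, Tendsto (fun v => ‖w - K v w • v‖) G (𝓝 ‖w - k w • x‖) := fun w =>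
    (tendsto_const_nhds.sub ((hlim w).smul hG)).norm
  have hk' : IsPolar x (WeakDual.toStrongDual k) := by
    constructor
    -- Here `K v x - 1 = K v (x - v)`, which is at most `2‖x - v‖ / ‖v‖`.
    · have h1 : Tendsto (fun v => ‖K v x - 1‖ * (‖x‖ / 2)) G (𝓝 0) := by
        have h2 : Tendsto (fun v => 2 * ‖v - x‖) G (𝓝 0) := by
          have : Tendsto (fun v => 2 * ‖v - x‖) G (𝓝 (2 * ‖x - x‖)) :=
            ((Tendsto.sub_const hG x).norm).const_mul 2
          simpa using this
        refine squeeze_zero' (Eventually.of_forall fun v => by positivity) ?_ h2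
        filter_upwards [hev] with v hv
        have hv0 : v ≠ 0 := norm_pos_iff.1 (by linarith)
        have h3 := norm_sub_le (x - v) ((x - v) - K v (x - v) • v)
        rw [sub_sub_cancel, norm_smul, map_sub, (hK v hv0).1] at h3
        have h4 := (hK v hv0).2 (x - v)
        rw [map_sub, (hK v hv0).1] at h4
        have h5 : ‖K v x - 1‖ * (‖x‖ / 2) ≤ ‖K v x - 1‖ * ‖v‖ := by gcongr
        rw [norm_sub_rev v x]
        linarith
      have h6 : Tendsto (fun v => ‖K v x - 1‖ * (‖x‖ / 2)) G (𝓝 (‖k x - 1‖ * (‖x‖ / 2))) :=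
        (((hlim x).sub_const 1).norm).mul_const _
      have h7 := tendsto_nhds_unique h6 h1
      have h8 := (mul_eq_zero.1 h7).resolve_right (by positivity)
      exact sub_eq_zero.1 (norm_eq_zero.1 h8)
    · intro w
      refine le_of_tendsto (hb w) ?_
      filter_upwards [hev] with v hv
      exact (hK v (norm_pos_iff.1 (by linarith))).2 w
  have hkx := hk'.unique hV (hK x hx)
  have := hlim y
  change Tendsto (fun v => K v y) G (𝓝 (K x y))
  rw [← hkx]
  exact this

variable [FiniteDimensional ℝ V]

theorem exists_attaining {f : V →L[ℝ] ℝ} (hf : f ≠ 0) :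
    ∃ (z : V) (c : ℝ), z ≠ 0 ∧ c ≠ 0 ∧ c * f z = ‖z‖ ∧ ∀ w, |c * f w| ≤ ‖w‖ := by
  have : ProperSpace V := FiniteDimensional.proper_real V
  obtain ⟨z, hz, hmax⟩ := (isCompact_closedBall (0 : V) 1).exists_isMaxOn
    ⟨0, by simp⟩ f.continuous.continuousOn
  have hz1 : ‖z‖ ≤ 1 := by simpa using hz
  have hle : ∀ w, f w ≤ f z * ‖w‖ := by
    intro w
    rcases eq_or_ne w 0 with rfl | hw
    · simp
    have hw0 : 0 < ‖w‖ := norm_pos_iff.2 hw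
    have : f (‖w‖⁻¹ • w) ≤ f z := hmax (by simp [norm_smul, hw0.ne'])
    rw [map_smul, smul_eq_mul, inv_mul_eq_div, div_le_iff₀ hw0] at this
    exact this
  have hpos : 0 < f z := by
    by_contra hneg
    refine hf (ContinuousLinearMap.ext fun w => ?_)
    have h1 := hle w
    have h2 := hle (-w)
    rw [map_neg, norm_neg] at h2
    have : f z * ‖w‖ ≤ 0 := mul_nonpos_of_nonpos_of_nonneg (not_lt.1 hneg) (norm_nonneg w)
    simp only [zero_apply]
    linarith
  have hb : ∀ w, |(f z)⁻¹ * f w| ≤ ‖w‖ := by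
    intro w
    rw [inv_mul_eq_div, abs_div, abs_of_pos hpos, div_le_iff₀ hpos, abs_le]
    have h1 := hle w
    have h2 := hle (-w)
    rw [map_neg, norm_neg] at h2
    constructor <;> linarith
  refine ⟨z, (f z)⁻¹, ?_, inv_ne_zero hpos.ne', ?_, hb⟩
  · rintro rfl
    simp at hpos
  · have := (le_abs_self _).trans (hb z)
    rw [inv_mul_cancel₀ hpos.ne'] at this ⊢
    linarith

/-- Take a functional vanishing at `x` and `y` and let `z` be a point where it attains its norm.
Projectively, `K` sends a line into the pencil of functionals killing `z`. -/
theorem IsPolarField.exists_common_zero (hV : IsRotund V) (hK : IsPolarField K)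
    (h3 : Module.finrank ℝ V = 3) (x y : V) :
    ∃ z : V, z ≠ 0 ∧ ∀ α β : ℝ, α • x + β • y ≠ 0 → K (α • x + β • y) z = 0 := by
  have hlt : Submodule.span ℝ ({x, y} : Set V) < ⊤ := by
    rw [lt_top_iff_ne_top]
    intro htop
    have h1 : Module.finrank ℝ (Submodule.span ℝ ({x, y} : Set V)) ≤ 2 := by
      classical
      have := finrank_span_finset_le_card (R := ℝ) ({x, y} : Finset V)
      rw [Finset.coe_pair] at this
      exact this.trans Finset.card_le_two
    rw [htop, finrank_top] at h1
    omega
  obtain ⟨f, hf, hker⟩ := Submodule.exists_le_ker_of_lt_top _ hlt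
  have hfx : f x = 0 := hker (Submodule.subset_span (by simp))
  have hfy : f y = 0 := hker (Submodule.subset_span (by simp))
  obtain ⟨z, c, hz, hc, hcz, hb⟩ := exists_attaining (f := LinearMap.toContinuousLinearMap f)
    (by simpa using hf)
  refine ⟨z, hz, fun α β hw => ?_⟩
  refine (hK _ hw).apply_eq_zero hV (f := c • LinearMap.toContinuousLinearMap f) hb hcz ?_
  simp [hfx, hfy]

theorem exists_combination_of_apply_eq_zero (h3 : Module.finrank ℝ V = 3) {z : V} (hz : z ≠ 0)
    {φ ψ χ : V →L[ℝ] ℝ} (hφ : φ z = 0) (hψ : ψ z = 0) (hχ : χ z = 0)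
    (hi : LinearIndependent ℝ ![φ, ψ]) : ∃ A B : ℝ, χ = A • φ + B • ψ := by
  have hd : Module.finrank ℝ (V →L[ℝ] ℝ) = 3 := by
    rw [← h3, ← (LinearMap.toContinuousLinearMap : (V →ₗ[ℝ] ℝ) ≃ₗ[ℝ] (V →L[ℝ] ℝ)).finrank_eq]
    exact Subspace.dual_finrank_eq
  have : FiniteDimensional ℝ (V →L[ℝ] ℝ) := Module.finite_of_finrank_pos (by omega)
  let ev : (V →L[ℝ] ℝ) →ₗ[ℝ] ℝ := (ContinuousLinearMap.apply ℝ ℝ z).toLinearMap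
  have hsurj : LinearMap.range ev = ⊤ := by
    obtain ⟨f, -, hf⟩ := exists_dual_vector ℝ z (norm_ne_zero_iff.2 hz)
    refine LinearMap.range_eq_top.2 (LinearMap.surjective (f := ev) fun h => ?_)
    have : ev f = 0 := by rw [h]; rfl
    exact norm_ne_zero_iff.2 hz (hf.symm.trans this)
  have hk := LinearMap.finrank_range_add_finrank_ker ev
  rw [hsurj, finrank_top, Module.finrank_self, hd] at hk
  have hle : Submodule.span ℝ (Set.range ![φ, ψ]) ≤ LinearMap.ker ev := by
    rw [Submodule.span_le]
    rintro _ ⟨i, rfl⟩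
    fin_cases i
    · exact hφ
    · exact hψ
  have hs : Module.finrank ℝ (Submodule.span ℝ (Set.range ![φ, ψ])) = 2 := by
    rw [finrank_span_eq_card hi, Fintype.card_fin]
  have heq := Submodule.eq_of_le_of_finrank_eq hle (by omega)
  have hmem : χ ∈ Submodule.span ℝ (Set.range ![φ, ψ]) := by rw [heq]; exact hχ
  rw [Matrix.range_cons, Matrix.range_cons, Matrix.range_empty, Set.union_empty,
    Set.singleton_union, Submodule.mem_span_pair] at hmem
  obtain ⟨A, B, h⟩ := hmem
  exact ⟨A, B, h.symm⟩

theorem IsPolarField.combination_of_not_parallel (hV : IsRotund V) (hK : IsPolarField K)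
    (h3 : Module.finrank ℝ V = 3) {x y : V} (hx : x ≠ 0) (hy : y ≠ 0)
    (hxy : ¬ ∃ c : ℝ, K x = c • K y) (α β : ℝ) (hw : α • x + β • y ≠ 0) :
    ∃ A B : ℝ, K (α • x + β • y) = A • K x + B • K y := by
  obtain ⟨z, hz, h⟩ := hK.exists_common_zero hV h3 x y
  have h1 := h 1 0 (by simpa using hx)
  have h2 := h 0 1 (by simpa using hy)
  simp only [one_smul, zero_smul, add_zero, zero_add] at h1 h2
  refine exists_combination_of_apply_eq_zero h3 hz h1 h2 (h α β hw) ?_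
  rw [LinearIndependent.pair_iff]
  intro s t hst
  have hs : s = 0 := by
    by_contra hs
    refine hxy ⟨-(s⁻¹ * t), ?_⟩
    have : K x = s⁻¹ • (s • K x) := by rw [smul_smul, inv_mul_cancel₀ hs, one_smul]
    rw [this, eq_neg_of_add_eq_zero_left hst, smul_neg, smul_smul]
    ext v
    simp
  refine ⟨hs, ?_⟩
  have := DFunLike.congr_fun hst y
  simpa [hs, (hK y hy).1] using this

/-- If `K a = K b`, the coincidence spreads along a direction `m` killed by the norming functionals
`f`, `g` of `z = a - b`: all `K (a + t • m)` are parallel to `K a`. But a suitable `t` either makes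
`K a` vanish at `a + t • m`, or else `K a m = 0`, which the limit `t → ∞` excludes. -/
theorem IsPolarField.injective (hV : IsRotund V) (hK : IsPolarField K)
    (h3 : Module.finrank ℝ V = 3) {a b : V} (ha : a ≠ 0) (hb : b ≠ 0) (hab : K a = K b) :
    a = b := by
  by_contra hne
  set z := a - b with hz
  have hz0 : z ≠ 0 := sub_ne_zero.2 hne
  have hn : ‖z‖ ≠ 0 := norm_ne_zero_iff.2 hz0
  have hKa : K a z = 0 := by rw [hz, map_sub, (hK a ha).1, hab, (hK b hb).1, sub_self]
  obtain ⟨f, hfa, hfz, hf⟩ := (hK a ha).exists_norming hKa hz0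
  obtain ⟨g, hgb, hgz, hg⟩ := (hK b hb).exists_norming (hab ▸ hKa) hz0
  obtain ⟨m, hm, hm0⟩ := Submodule.exists_mem_ne_zero_of_ne_bot
    (LinearMap.ker_ne_bot_of_finrank_lt (f := f.toLinearMap.prod g.toLinearMap) (by
      rw [h3, Module.finrank_prod, Module.finrank_self]; omega))
  have hfm : f m = 0 := (Prod.ext_iff.1 (LinearMap.mem_ker.1 hm)).1
  have hgm : g m = 0 := (Prod.ext_iff.1 (LinearMap.mem_ker.1 hm)).2
  have hfb : f b = -‖z‖ := by
    have : b = a - z := by rw [hz]; abel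
    rw [this, map_sub, hfa, hfz]; ring
  have hga : g a = ‖z‖ := by
    have : a = b + z := by rw [hz]; abel
    rw [this, map_add, hgb, hgz]; ring
  have hat : ∀ t : ℝ, a + t • m ≠ 0 := fun t h => by
    have := congrArg g h
    simp [hga, hgm, hn] at this
  have hbt : ∀ t : ℝ, b + t • m ≠ 0 := fun t h => by
    have := congrArg f h
    simp [hfb, hfm, hn] at this
  have hzt : ∀ t : ℝ, z + t • m ≠ 0 := fun t h => by
    have := congrArg f h
    simp [hfz, hfm, hn] at this
  have hKat : ∀ t : ℝ, K (a + t • m) z = 0 := fun t =>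
    (hK _ (hat t)).apply_eq_zero hV hf hfz (by simp [hfa, hfm])
  have hKbt : ∀ t : ℝ, K (b + t • m) z = 0 := fun t =>
    (hK _ (hbt t)).apply_eq_zero hV hg hgz (by simp [hgb, hgm])
  obtain ⟨δ, hδ, hKz⟩ : ∃ δ > 0, ∀ t : ℝ, |t| < δ → K (z + t • m) z ≠ 0 := by
    have hc : ContinuousAt (fun t : ℝ => K (z + t • m) z) 0 := by
      have h1 := hK.continuousAt hV hz0 z
      have h2 : ContinuousAt (fun t : ℝ => z + t • m) 0 := by fun_prop
      exact ContinuousAt.comp (g := fun v => K v z) (by simpa using h1) h2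
    have h0 : K (z + (0 : ℝ) • m) z ≠ 0 := by simp [(hK z hz0).1]
    obtain ⟨δ, hδ, h⟩ := Metric.eventually_nhds_iff.1 (hc.eventually_ne h0)
    exact ⟨δ, hδ, fun t ht => h (by simpa [Real.dist_eq] using ht)⟩
  -- Otherwise `K` at the difference `z + (t - t') • m` is a combination of two functionals killing
  -- `z`, contrary to the choice of `δ`.
  have hpar : ∀ t t' : ℝ, |t - t'| < δ → ∃ c : ℝ, K (a + t • m) = c • K (b + t' • m) := by
    intro t t' htt
    by_contra hcon
    have hw : (1 : ℝ) • (a + t • m) + (-1 : ℝ) • (b + t' • m) = z + (t - t') • m := by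
      rw [hz]; module
    obtain ⟨A, B, h⟩ := hK.combination_of_not_parallel hV h3 (hat t) (hbt t') hcon 1 (-1)
      (by rw [hw]; exact hzt _)
    rw [hw] at h
    refine hKz _ htt ?_
    rw [h]
    simp [hKat, hKbt]
  have hpar' : ∀ t t' : ℝ, |t - t'| < δ → ∃ c : ℝ, K (a + t • m) = c • K (a + t' • m) := by
    intro t t' htt
    obtain ⟨c, hc⟩ := hpar t t' htt
    obtain ⟨d, hd⟩ := hpar t' t' (by simpa using hδ)
    have hd0 : d ≠ 0 := by
      rintro rfl
      have := (hK _ (hat t')).1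
      simp [hd] at this
    exact ⟨c * d⁻¹, by rw [hc, hd, smul_smul, mul_assoc, inv_mul_cancel₀ hd0, mul_one]⟩
  have hstep : ∀ ε : ℝ, |ε| < δ → ∀ n : ℕ, ∃ c : ℝ, K (a + ((n : ℝ) * ε) • m) = c • K a := by
    intro ε hε n
    induction n with
    | zero => exact ⟨1, by simp⟩
    | succ n ih =>
      obtain ⟨c, hc⟩ := ih
      obtain ⟨d, hd⟩ := hpar' (((n + 1 : ℕ) : ℝ) * ε) ((n : ℝ) * ε) (by
        have : ((n + 1 : ℕ) : ℝ) * ε - (n : ℝ) * ε = ε := by push_cast; ring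
        rwa [this])
      exact ⟨d * c, by rw [hd, hc, smul_smul]⟩
  have hall : ∀ t : ℝ, ∃ c : ℝ, K (a + t • m) = c • K a := by
    intro t
    obtain ⟨n, hn⟩ := exists_nat_gt (|t| / δ)
    have hn0 : 0 < (n : ℝ) := lt_of_le_of_lt (by positivity) hn
    obtain ⟨c, hc⟩ := hstep (t / n) (by
      rw [abs_div, abs_of_pos hn0, div_lt_iff₀ hn0]
      rw [div_lt_iff₀ hδ] at hn
      linarith) n
    rw [mul_div_cancel₀ _ hn0.ne'] at hc
    exact ⟨c, hc⟩
  have hsmall : ∀ s : ℝ, s ≠ 0 → K (m + s • a) m = K (m + s • a) a * K a m := by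
    intro s hs
    obtain ⟨c, hc⟩ := hall s⁻¹
    have h1 : m + s • a = s • (a + s⁻¹ • m) := by
      rw [smul_add, smul_smul, mul_inv_cancel₀ hs, one_smul, add_comm]
    rw [h1, hK.smul hV (hat _) hs, hc]
    simp [(hK a ha).1, mul_assoc]
  -- The limit `s → 0` reaches the point at infinity `m` of the line `a + ℝ m`.
  have hlim : K m m = K m a * K a m := by
    have hc : ∀ y, ContinuousAt (fun s : ℝ => K (m + s • a) y) 0 := fun y => by
      have h1 := hK.continuousAt hV hm0 y
      have h2 : ContinuousAt (fun s : ℝ => m + s • a) 0 := by fun_prop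
      exact ContinuousAt.comp (g := fun v => K v y) (by simpa using h1) h2
    have l1 : Tendsto (fun s : ℝ => K (m + s • a) m) (𝓝[≠] 0) (𝓝 (K m m)) := by
      have := (hc m).tendsto.mono_left (nhdsWithin_le_nhds (s := {0}ᶜ))
      simpa using this
    have l2 : Tendsto (fun s : ℝ => K (m + s • a) a * K a m) (𝓝[≠] 0) (𝓝 (K m a * K a m)) := by
      have := ((hc a).tendsto.mono_left (nhdsWithin_le_nhds (s := {0}ᶜ))).mul_const (K a m)
      simpa using this
    refine tendsto_nhds_unique l1 (l2.congr' ?_)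
    filter_upwards [self_mem_nhdsWithin] with s hs
    exact (hsmall s hs).symm
  rw [(hK m hm0).1] at hlim
  have hKam : K a m ≠ 0 := by
    intro h
    rw [h, mul_zero] at hlim
    exact one_ne_zero hlim
  obtain ⟨c, hc⟩ := hall (-(K a m)⁻¹)
  have h1 := (hK _ (hat (-(K a m)⁻¹))).1
  rw [hc] at h1
  simp [(hK a ha).1, hKam] at h1

theorem IsPolarField.eq_smul_of_parallel (hV : IsRotund V) (hK : IsPolarField K)
    (h3 : Module.finrank ℝ V = 3) {x y : V} (hx : x ≠ 0) (hy : y ≠ 0) {c : ℝ}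
    (h : K x = c • K y) : ∃ d : ℝ, x = d • y := by
  have hc : c ≠ 0 := by
    rintro rfl
    have := (hK x hx).1
    simp [h] at this
  refine ⟨c⁻¹, hK.injective hV h3 hx (smul_ne_zero (inv_ne_zero hc) hy) ?_⟩
  rw [hK.smul hV hy (inv_ne_zero hc), inv_inv, h]

theorem IsPolarField.combination (hV : IsRotund V) (hK : IsPolarField K)
    (h3 : Module.finrank ℝ V = 3) {x y : V} (hx : x ≠ 0) (hy : y ≠ 0)
    (hxy : ¬ ∃ c : ℝ, x = c • y) (α β : ℝ) (hw : α • x + β • y ≠ 0) :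
    ∃ A B : ℝ, K (α • x + β • y) = A • K x + B • K y := by
  refine hK.combination_of_not_parallel hV h3 hx hy ?_ α β hw
  rintro ⟨c, hc⟩
  exact hxy (hK.eq_smul_of_parallel hV h3 hx hy hc)

end Polar

/-! ### The collineation in projective coordinates: it is diagonal -/

section Frame

variable {V : Type*} [NormedAddCommGroup V] [NormedSpace ℝ V]

/-- A biorthogonality condition for three vectors and the functionals attached to them. -/
structure IsPolarFrame (K : V → V →L[ℝ] ℝ) (e₁ e₂ e₃ : V) : Prop where
  h11 : K e₁ e₁ = 1
  h12 : K e₁ e₂ = 0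
  h13 : K e₁ e₃ = 0
  h21 : K e₂ e₁ = 0
  h22 : K e₂ e₂ = 1
  h23 : K e₂ e₃ = 0
  h31 : K e₃ e₁ = 0
  h32 : K e₃ e₂ = 0
  h33 : K e₃ e₃ = 1

variable {K : V → V →L[ℝ] ℝ} {e₁ e₂ e₃ : V}

theorem IsPolarFrame.swap (h : IsPolarFrame K e₁ e₂ e₃) : IsPolarFrame K e₂ e₁ e₃ :=
  ⟨h.h22, h.h21, h.h23, h.h12, h.h11, h.h13, h.h32, h.h31, h.h33⟩

theorem IsPolarFrame.ne_zero₁ (h : IsPolarFrame K e₁ e₂ e₃) : e₁ ≠ 0 := by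
  rintro rfl
  simpa using h.h11

theorem IsPolarFrame.ne_zero₂ (h : IsPolarFrame K e₁ e₂ e₃) : e₂ ≠ 0 := h.swap.ne_zero₁

theorem IsPolarFrame.ne_zero₃ (h : IsPolarFrame K e₁ e₂ e₃) : e₃ ≠ 0 := by
  rintro rfl
  simpa using h.h33

theorem IsPolarFrame.add_ne_zero (h : IsPolarFrame K e₁ e₂ e₃) (α β : ℝ) :
    e₃ + α • e₁ + β • e₂ ≠ 0 := fun h0 => by
  have := congrArg (K e₃) h0
  simp [h.h31, h.h32, h.h33] at this

theorem IsPolarFrame.add_ne_zero' (h : IsPolarFrame K e₁ e₂ e₃) (α : ℝ) :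
    e₃ + α • e₁ ≠ 0 := fun h0 => by
  have := congrArg (K e₃) h0
  simp [h.h31, h.h33] at this

/-- The action of `K` on the affine line `e₃ + ℝ e₁`, in projective coordinates. -/
noncomputable def polarRatio (K : V → V →L[ℝ] ℝ) (e₁ e₃ : V) (α : ℝ) : ℝ :=
  K (e₃ + α • e₁) e₁ / K (e₃ + α • e₁) e₃

theorem IsPolarFrame.polarRatio_zero (h : IsPolarFrame K e₁ e₂ e₃) :
    polarRatio K e₁ e₃ 0 = 0 := by
  simp [polarRatio, h.h31]

variable [FiniteDimensional ℝ V]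

theorem IsPolarFrame.apply_plane (hV : IsRotund V) (hK : IsPolarField K)
    (hd : Module.finrank ℝ V = 3) (h : IsPolarFrame K e₁ e₂ e₃) {α β : ℝ}
    (hw : α • e₁ + β • e₂ ≠ 0) : K (α • e₁ + β • e₂) e₃ = 0 := by
  obtain ⟨A, B, hAB⟩ := hK.combination hV hd h.ne_zero₁ h.ne_zero₂ (by
    rintro ⟨c, hc⟩
    have := congrArg (K e₁) hc
    simp [h.h11, h.h12] at this) α β hw
  rw [hAB]
  simp [h.h13, h.h23]

/-- Otherwise `K e₃`, a combination of `K` at this point and at `α • e₁ + β • e₂`, would kill `e₃`.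
-/
theorem IsPolarFrame.apply_third_ne_zero (hV : IsRotund V) (hK : IsPolarField K)
    (hd : Module.finrank ℝ V = 3) (h : IsPolarFrame K e₁ e₂ e₃) (α β : ℝ) :
    K (e₃ + α • e₁ + β • e₂) e₃ ≠ 0 := by
  by_cases hw : α • e₁ + β • e₂ = 0
  · rw [add_assoc, hw, add_zero, h.h33]
    exact one_ne_zero
  intro h0
  have heq : (1 : ℝ) • (e₃ + α • e₁ + β • e₂) + (-1 : ℝ) • (α • e₁ + β • e₂) = e₃ := by module
  obtain ⟨A, B, hAB⟩ := hK.combination hV hd (h.add_ne_zero α β) hw (by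
    rintro ⟨c, hc⟩
    have := congrArg (K e₃) hc
    simp [h.h31, h.h32, h.h33] at this) 1 (-1) (by rw [heq]; exact h.ne_zero₃)
  rw [heq] at hAB
  have := h.h33
  rw [hAB] at this
  simp [h0, h.apply_plane hV hK hd hw] at this

theorem IsPolarFrame.apply_third_ne_zero' (hV : IsRotund V) (hK : IsPolarField K)
    (hd : Module.finrank ℝ V = 3) (h : IsPolarFrame K e₁ e₂ e₃) (α : ℝ) :
    K (e₃ + α • e₁) e₃ ≠ 0 := by
  simpa using h.apply_third_ne_zero hV hK hd α 0

/-- Moving in the direction `e₂` adds a multiple of `K e₂`, which kills `e₁` and `e₃`; the ratio of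
the two values therefore does not depend on `β`. -/
theorem IsPolarFrame.apply_first (hV : IsRotund V) (hK : IsPolarField K)
    (hd : Module.finrank ℝ V = 3) (h : IsPolarFrame K e₁ e₂ e₃) (α β : ℝ) :
    K (e₃ + α • e₁ + β • e₂) e₁ = polarRatio K e₁ e₃ α * K (e₃ + α • e₁ + β • e₂) e₃ := by
  have heq : (1 : ℝ) • (e₃ + α • e₁) + β • e₂ = e₃ + α • e₁ + β • e₂ := by module
  obtain ⟨A, B, hAB⟩ := hK.combination hV hd (h.add_ne_zero' α) h.ne_zero₂ (by
    rintro ⟨c, hc⟩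
    have := congrArg (K e₃) hc
    simp [h.h31, h.h32, h.h33] at this) 1 β (by rw [heq]; exact h.add_ne_zero α β)
  rw [heq] at hAB
  have h0 := h.apply_third_ne_zero' hV hK hd α
  rw [hAB, polarRatio]
  simp [h.h21, h.h23]
  field_simp

theorem IsPolarFrame.apply_second (hV : IsRotund V) (hK : IsPolarField K)
    (hd : Module.finrank ℝ V = 3) (h : IsPolarFrame K e₁ e₂ e₃) (α β : ℝ) :
    K (e₃ + α • e₁ + β • e₂) e₂ = polarRatio K e₂ e₃ β * K (e₃ + α • e₁ + β • e₂) e₃ := by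
  rw [add_right_comm]
  exact h.swap.apply_first hV hK hd β α

theorem IsPolarFrame.polarRatio_ne_zero (hV : IsRotund V) (hK : IsPolarField K)
    (hd : Module.finrank ℝ V = 3) (h : IsPolarFrame K e₁ e₂ e₃) {α : ℝ} (hα : α ≠ 0) :
    polarRatio K e₁ e₃ α ≠ 0 := by
  refine div_ne_zero (fun h0 => ?_) (h.apply_third_ne_zero' hV hK hd α)
  obtain ⟨A, B, hAB⟩ := hK.combination hV hd h.ne_zero₃ h.ne_zero₁ (by
    rintro ⟨c, hc⟩
    have := congrArg (K e₃) hc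
    simp [h.h31, h.h33] at this) 1 α (by rw [one_smul]; exact h.add_ne_zero' α)
  rw [one_smul] at hAB
  rw [hAB] at h0
  have hB : B = 0 := by simpa [h.h31, h.h11] using h0
  rw [hB, zero_smul, add_zero] at hAB
  obtain ⟨c, hc⟩ := hK.eq_smul_of_parallel hV hd (h.add_ne_zero' α) h.ne_zero₃ hAB
  have := congrArg (K e₁) hc
  simp [h.h13, h.h11, hα] at this

/-- The point at infinity `α • e₁ + β • e₂` is collinear with `e₃` and `e₃ + α • e₁ + β • e₂`, and
`K e₃` does not affect the values at `e₁` and `e₂`. -/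
theorem IsPolarFrame.plane_ratio (hV : IsRotund V) (hK : IsPolarField K)
    (hd : Module.finrank ℝ V = 3) (h : IsPolarFrame K e₁ e₂ e₃) {α β : ℝ}
    (hw : α • e₁ + β • e₂ ≠ 0) :
    K (α • e₁ + β • e₂) e₁ * polarRatio K e₂ e₃ β =
      K (α • e₁ + β • e₂) e₂ * polarRatio K e₁ e₃ α := by
  have heq : (1 : ℝ) • e₃ + (1 : ℝ) • (α • e₁ + β • e₂) = e₃ + α • e₁ + β • e₂ := by module
  obtain ⟨A, B, hAB⟩ := hK.combination hV hd h.ne_zero₃ hw (by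
    rintro ⟨c, hc⟩
    have := congrArg (K e₃) hc
    simp [h.h31, h.h32, h.h33] at this) 1 1 (by rw [heq]; exact h.add_ne_zero α β)
  rw [heq] at hAB
  have h1 := h.apply_first hV hK hd α β
  have h2 := h.apply_second hV hK hd α β
  have h3 := h.apply_third_ne_zero hV hK hd α β
  set c := K (e₃ + α • e₁ + β • e₂) e₃
  rw [hAB] at h1 h2
  simp only [add_apply, smul_apply, smul_eq_mul, h.h31, h.h32, mul_zero, zero_add] at h1 h2
  apply mul_right_cancel₀ h3
  rw [mul_assoc, ← h2, mul_assoc, ← h1]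
  ring

theorem IsPolarFrame.polarRatio_add (hV : IsRotund V) (hK : IsPolarField K)
    (hd : Module.finrank ℝ V = 3) (h : IsPolarFrame K e₁ e₂ e₃) (α α' : ℝ) :
    polarRatio K e₁ e₃ (α + α') = polarRatio K e₁ e₃ α + polarRatio K e₁ e₃ α' := by
  rcases eq_or_ne α' 0 with rfl | hα'
  · rw [h.polarRatio_zero, add_zero, add_zero]
  have hw : α' • e₁ + (-1 : ℝ) • e₂ ≠ 0 := fun h0 => by
    have := congrArg (K e₂) h0
    simp [h.h21, h.h22] at this
  -- The increment over a step `α'` is read off from the fixed direction `α' • e₁ - e₂`, which leads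
  -- from height one over `α` to height zero over `α + α'`. The right side is independent of `α`, so
  -- comparison with `α = 0` gives additivity.
  have key : ∀ α, (polarRatio K e₁ e₃ (α + α') - polarRatio K e₁ e₃ α) * polarRatio K e₂ e₃ (-1)
      = -polarRatio K e₂ e₃ 1 * polarRatio K e₁ e₃ α' := by
    intro α
    have heq : (1 : ℝ) • (e₃ + α • e₁ + (1 : ℝ) • e₂) + (1 : ℝ) • (α' • e₁ + (-1 : ℝ) • e₂)
        = e₃ + (α + α') • e₁ + (0 : ℝ) • e₂ := by module
    obtain ⟨A, B, hAB⟩ := hK.combination hV hd (h.add_ne_zero α 1) hw (by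
      rintro ⟨c, hc⟩
      have := congrArg (K e₃) hc
      simp [h.h31, h.h32, h.h33] at this) 1 1 (by rw [heq]; exact h.add_ne_zero _ _)
    rw [heq] at hAB
    have a1 := h.apply_first hV hK hd (α + α') 0
    have a2 := h.apply_second hV hK hd (α + α') 0
    have a3 := h.apply_third_ne_zero hV hK hd (α + α') 0
    rw [h.swap.polarRatio_zero, zero_mul] at a2
    rw [hAB] at a1 a2 a3
    simp only [add_apply, smul_apply, smul_eq_mul, h.apply_plane hV hK hd hw, mul_zero,
      add_zero] at a1 a2 a3
    have b1 := h.apply_first hV hK hd α 1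
    have b2 := h.apply_second hV hK hd α 1
    have b3 := h.plane_ratio hV hK hd hw
    rw [b1] at a1
    rw [b2] at a2
    apply mul_left_cancel₀ a3
    linear_combination (-polarRatio K e₂ e₃ (-1)) * a1 + polarRatio K e₁ e₃ α' * a2 + B * b3
  have k0 := key 0
  rw [zero_add, h.polarRatio_zero, sub_zero] at k0
  have := key α
  rw [← k0] at this
  have := mul_right_cancel₀ (h.swap.polarRatio_ne_zero hV hK hd (by norm_num)) this
  linarith

theorem IsPolarFrame.polarRatio_eq (hV : IsRotund V) (hK : IsPolarField K)
    (hd : Module.finrank ℝ V = 3) (h : IsPolarFrame K e₁ e₂ e₃) (α : ℝ) :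
    polarRatio K e₁ e₃ α = polarRatio K e₁ e₃ 1 * α := by
  have hc : Continuous (polarRatio K e₁ e₃) := by
    rw [continuous_iff_continuousAt]
    intro α
    have hy : ∀ y, ContinuousAt (fun α : ℝ => K (e₃ + α • e₁) y) α := fun y =>
      ContinuousAt.comp (g := fun v => K v y) (hK.continuousAt hV (h.add_ne_zero' α) y)
        (by fun_prop)
    exact (hy e₁).div (hy e₃) (h.apply_third_ne_zero' hV hK hd α)
  let f : ℝ →+ ℝ :=
    { toFun := polarRatio K e₁ e₃
      map_zero' := h.polarRatio_zero
      map_add' := h.polarRatio_add hV hK hd }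
  have := (f.toRealLinearMap hc).map_smul α 1
  simp only [smul_eq_mul, mul_one] at this
  rw [mul_comm]
  exact this

/-- The functionals of a polar field on a three-dimensional space are projectively given by a
symmetric matrix, which is diagonal in any polar frame. -/
theorem IsPolarFrame.exists_diagonal (hV : IsRotund V) (hK : IsPolarField K)
    (hd : Module.finrank ℝ V = 3) (h : IsPolarFrame K e₁ e₂ e₃) :
    ∃ r s : ℝ, 0 < r ∧ 0 < s ∧ ∀ α β γ : ℝ, α • e₁ + β • e₂ + γ • e₃ ≠ 0 → ∃ c : ℝ, c ≠ 0 ∧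
      c * K (α • e₁ + β • e₂ + γ • e₃) e₁ = r * α ∧ c * K (α • e₁ + β • e₂ + γ • e₃) e₂ = s * β ∧
      c * K (α • e₁ + β • e₂ + γ • e₃) e₃ = γ := by
  set r := polarRatio K e₁ e₃ 1 with hr
  set s := polarRatio K e₂ e₃ 1 with hs
  have hr0 : r ≠ 0 := h.polarRatio_ne_zero hV hK hd one_ne_zero
  have hs0 : s ≠ 0 := h.swap.polarRatio_ne_zero hV hK hd one_ne_zero
  have main : ∀ α β γ : ℝ, α • e₁ + β • e₂ + γ • e₃ ≠ 0 → ∃ c : ℝ,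
      c * K (α • e₁ + β • e₂ + γ • e₃) e₁ = r * α ∧ c * K (α • e₁ + β • e₂ + γ • e₃) e₂ = s * β ∧
      c * K (α • e₁ + β • e₂ + γ • e₃) e₃ = γ := by
    intro α β γ hx
    rcases eq_or_ne γ 0 with rfl | hγ
    · rw [zero_smul, add_zero] at hx ⊢
      have h1 := h.plane_ratio hV hK hd hx
      rw [h.polarRatio_eq hV hK hd, h.swap.polarRatio_eq hV hK hd, ← hr, ← hs] at h1
      have h2 := (hK _ hx).1
      rw [map_add, map_smul, map_smul, smul_eq_mul, smul_eq_mul] at h2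
      have h3 := h.apply_plane hV hK hd hx
      set d₁ := K (α • e₁ + β • e₂) e₁
      set d₂ := K (α • e₁ + β • e₂) e₂
      -- Since `K x x = 1`, the factor must be the value of the quadratic form at `x`.
      refine ⟨r * α * α + s * β * β, ?_, ?_, by rw [h3, mul_zero]⟩
      · linear_combination β * h1 + r * α * h2
      · linear_combination -α * h1 + s * β * h2
    · have heq : α • e₁ + β • e₂ + γ • e₃ = γ • (e₃ + (α / γ) • e₁ + (β / γ) • e₂) := by
        rw [smul_add, smul_add, smul_smul, smul_smul, mul_div_cancel₀ _ hγ, mul_div_cancel₀ _ hγ]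
        abel
      have a1 := h.apply_first hV hK hd (α / γ) (β / γ)
      have a2 := h.apply_second hV hK hd (α / γ) (β / γ)
      have a3 := h.apply_third_ne_zero hV hK hd (α / γ) (β / γ)
      rw [h.polarRatio_eq hV hK hd, ← hr] at a1
      rw [h.swap.polarRatio_eq hV hK hd, ← hs] at a2
      rw [heq, hK.smul hV (h.add_ne_zero _ _) hγ]
      simp only [smul_apply, smul_eq_mul]
      rw [a1, a2]
      set d := K (e₃ + (α / γ) • e₁ + (β / γ) • e₂) e₃
      refine ⟨γ * γ / d, ?_, ?_, ?_⟩ <;> field_simp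
  have hc : ∀ α β γ : ℝ, α • e₁ + β • e₂ + γ • e₃ ≠ 0 →
      r * α * α + s * β * β + γ * γ ≠ 0 := by
    intro α β γ hx h0
    obtain ⟨c, c1, c2, c3⟩ := main α β γ hx
    have h2 := (hK _ hx).1
    rw [map_add, map_add, map_smul, map_smul, map_smul, smul_eq_mul, smul_eq_mul, smul_eq_mul] at h2
    have hc0 : c = 0 := by linear_combination -c * h2 + α * c1 + β * c2 + γ * c3 + h0
    rw [hc0, zero_mul] at c1 c2 c3
    have hα : α = 0 := (mul_eq_zero.1 c1.symm).resolve_left hr0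
    have hβ : β = 0 := (mul_eq_zero.1 c2.symm).resolve_left hs0
    apply hx
    rw [hα, hβ, ← c3]
    simp
  have hrpos : 0 < r := by
    by_contra hneg
    -- If `r ≤ 0`, then `e₁ + √(-r) • e₃` is a nonzero isotropic vector.
    refine hc 1 0 (√(-r)) (fun h0 => ?_) ?_
    · have := congrArg (K e₁) h0
      simp [h.h11, h.h13] at this
    · rw [Real.mul_self_sqrt (by linarith)]; ring
  have hspos : 0 < s := by
    by_contra hneg
    refine hc 0 1 (√(-s)) (fun h0 => ?_) ?_
    · have := congrArg (K e₂) h0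
      simp [h.h22, h.h23] at this
    · rw [Real.mul_self_sqrt (by linarith)]; ring
  refine ⟨r, s, hrpos, hspos, fun α β γ hx => ?_⟩
  obtain ⟨c, c1, c2, c3⟩ := main α β γ hx
  refine ⟨c, ?_, c1, c2, c3⟩
  rintro rfl
  refine hc α β γ hx ?_
  linear_combination -α * c1 - β * c2 - γ * c3

end Frame

/-! ### From polar orthogonality to a Euclidean norm in dimension three -/

section Parallelogram

/-- Divide the angle `θ` into `n` steps. Each costs a factor at least `1 - θ² / (2n²)`, so by
Bernoulli the total loss is `O(1/n)`. -/
theorem le_of_forall_cos_mul_le {F : ℝ → ℝ} (hF : ∀ t, 0 ≤ F t)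
    (h : ∀ t t', |Real.cos (t' - t)| * F t ≤ F t') (t t' : ℝ) : F t ≤ F t' := by
  set θ := t' - t with hθ
  have key : ∀ n : ℕ, 0 < n → θ ^ 2 / 2 ≤ n → (1 - θ ^ 2 / 2 / n) * F t ≤ F t' := by
    intro n hn hθn
    have hn0 : (0 : ℝ) < n := by exact_mod_cast hn
    have hn1 : (1 : ℝ) ≤ n := by exact_mod_cast hn
    set ε := (θ / n) ^ 2 / 2 with hε
    have hεn : n * ε = θ ^ 2 / 2 / n := by rw [hε]; field_simp
    have hε1 : ε ≤ 1 := by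
      have h1 : n * ε ≤ 1 := by rw [hεn, div_le_one hn0]; exact hθn
      have h2 : 0 ≤ ε := by positivity
      nlinarith
    have step : ∀ k : ℕ, (1 - ε) ^ k * F t ≤ F (t + k * (θ / n)) := by
      intro k
      induction k with
      | zero => simp
      | succ k ih =>
        have h1 := h (t + k * (θ / n)) (t + (k + 1 : ℕ) * (θ / n))
        have h2 : t + (k + 1 : ℕ) * (θ / n) - (t + k * (θ / n)) = θ / n := by push_cast; ring
        rw [h2] at h1
        have h3 := (Real.one_sub_sq_div_two_le_cos (x := θ / n)).trans (le_abs_self _)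
        calc (1 - ε) ^ (k + 1) * F t = (1 - ε) * ((1 - ε) ^ k * F t) := by ring
          _ ≤ (1 - ε) * F (t + k * (θ / n)) := by gcongr
          _ ≤ |Real.cos (θ / n)| * F (t + k * (θ / n)) :=
            mul_le_mul_of_nonneg_right h3 (hF _)
          _ ≤ _ := h1
    have h4 := step n
    rw [mul_div_cancel₀ _ hn0.ne', hθ, add_sub_cancel] at h4
    have h5 := one_add_mul_le_pow (a := -ε) (by linarith) n
    rw [← sub_eq_add_neg, mul_neg, hεn, ← sub_eq_add_neg] at h5
    exact (mul_le_mul_of_nonneg_right h5 (hF t)).trans h4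
  have hlim : Tendsto (fun n : ℕ => (1 - θ ^ 2 / 2 / n) * F t) atTop (𝓝 ((1 - 0) * F t)) :=
    (tendsto_const_nhds.sub (tendsto_const_div_atTop_nhds_zero_nat _)).mul_const _
  rw [sub_zero, one_mul] at hlim
  refine le_of_tendsto hlim ?_
  obtain ⟨m, hm⟩ := exists_nat_ge (θ ^ 2 / 2)
  filter_upwards [eventually_ge_atTop (max 1 m)] with n hn
  exact key n (le_of_max_le_left hn) (hm.trans (by exact_mod_cast le_of_max_le_right hn))

/-- Join `z` to `v` by a great circle and apply the angular estimate; when `v = ±z` the hypothesis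
suffices directly. -/
theorem le_of_forall_inner_mul_le {E : Type*} [NormedAddCommGroup E] [InnerProductSpace ℝ E]
    {N : E → ℝ} (hN : ∀ v, 0 ≤ N v) (h : ∀ v z, |inner ℝ v z| * N z ≤ N v * ‖z‖ ^ 2) {z v : E}
    (hz : ‖z‖ = 1) (hv : ‖v‖ = 1) : N z ≤ N v := by
  set c := inner ℝ v z with hc
  have hzz : inner ℝ z z = 1 := by rw [real_inner_self_eq_norm_sq, hz, one_pow]
  have hvv : inner ℝ v v = 1 := by rw [real_inner_self_eq_norm_sq, hv, one_pow]
  have hzv : inner ℝ z v = c := by rw [real_inner_comm]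
  rcases eq_or_ne (v - c • z) 0 with hw | hw
  · have hvc : v = c • z := sub_eq_zero.1 hw
    have h1 : |c| = 1 := by
      have := congrArg norm hvc
      rwa [norm_smul, hz, hv, mul_one, Real.norm_eq_abs, eq_comm] at this
    simpa [hz, ← hc, h1] using h v z
  set d := ‖v - c • z‖ with hd
  have hd0 : d ≠ 0 := norm_ne_zero_iff.2 hw
  have hcd : c ^ 2 + d ^ 2 = 1 := by
    rw [hd, ← real_inner_self_eq_norm_sq, inner_sub_left, inner_sub_right, inner_sub_right,
      inner_smul_left, inner_smul_left, inner_smul_right, inner_smul_right, hzz, hvv, hzv, ← hc]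
    simp only [RCLike.conj_to_real]
    ring
  set w := d⁻¹ • (v - c • z) with hwd
  have hzw : inner ℝ z w = 0 := by
    rw [hwd, inner_smul_right, inner_sub_right, inner_smul_right, hzz, hzv]
    ring
  have hww : inner ℝ w w = 1 := by
    rw [real_inner_self_eq_norm_sq, hwd, norm_smul, norm_inv, hd, norm_norm,
      inv_mul_cancel₀ hd0, one_pow]
  have hwz : inner ℝ w z = 0 := by rw [real_inner_comm, hzw]
  set γ : ℝ → E := fun t => Real.cos t • z + Real.sin t • w with hγ
  have hin : ∀ t t', inner ℝ (γ t') (γ t) = Real.cos (t' - t) := by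
    intro t t'
    simp only [hγ, inner_add_left, inner_add_right, inner_smul_left, inner_smul_right, hzz, hww,
      hzw, hwz, RCLike.conj_to_real, Real.cos_sub]
    ring
  have hnorm : ∀ t, ‖γ t‖ ^ 2 = 1 := fun t => by
    rw [← real_inner_self_eq_norm_sq, hin, sub_self, Real.cos_zero]
  have hle := le_of_forall_cos_mul_le (F := fun t => N (γ t)) (fun t => hN _) (fun t t' => by
    have := h (γ t') (γ t)
    rwa [hin, hnorm, mul_one] at this) 0 (Real.arccos c)
  have hdpos : 0 < d := lt_of_le_of_ne (norm_nonneg _) hd0.symm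
  have hc1 : -1 ≤ c := by nlinarith
  have hc2 : c ≤ 1 := by nlinarith
  have hs : Real.sin (Real.arccos c) = d := by
    rw [Real.sin_arccos, show 1 - c ^ 2 = d ^ 2 by linarith, Real.sqrt_sq hdpos.le]
  have hend : γ (Real.arccos c) = v := by
    simp only [hγ]
    rw [Real.cos_arccos hc1 hc2, hs, hwd, smul_smul, mul_inv_cancel₀ hd0, one_smul]
    abel
  have hstart : γ 0 = z := by simp [hγ]
  simpa only [hend, hstart] using hle

/-- The parallelogram law. -/
def SatisfiesParallelogram (V : Type*) [NormedAddCommGroup V] : Prop :=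
  ∀ x y : V, ‖x + y‖ * ‖x + y‖ + ‖x - y‖ * ‖x - y‖ = 2 * (‖x‖ * ‖x‖ + ‖y‖ * ‖y‖)

variable {V : Type*} [NormedAddCommGroup V] [NormedSpace ℝ V]

theorem satisfiesParallelogram_of_inner_le {E : Type*} [NormedAddCommGroup E]
    [InnerProductSpace ℝ E] (Φ : E →ₗ[ℝ] V) (hΦ : Function.Surjective Φ)
    (h : ∀ v z, |inner ℝ v z| * ‖Φ z‖ ≤ ‖Φ v‖ * ‖z‖ ^ 2) : SatisfiesParallelogram V := by
  obtain ⟨C, hC⟩ : ∃ C : ℝ, ∀ z, ‖Φ z‖ = C * ‖z‖ := by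
    by_cases hex : ∃ z : E, ‖z‖ = 1
    · obtain ⟨e, he⟩ := hex
      refine ⟨‖Φ e‖, fun z => ?_⟩
      rcases eq_or_ne z 0 with rfl | hz
      · simp
      have hz0 : ‖z‖ ≠ 0 := norm_ne_zero_iff.2 hz
      have hu : ‖‖z‖⁻¹ • z‖ = 1 := by rw [norm_smul, norm_inv, norm_norm, inv_mul_cancel₀ hz0]
      have heq : ‖Φ (‖z‖⁻¹ • z)‖ = ‖Φ e‖ := le_antisymm
        (le_of_forall_inner_mul_le (N := fun v => ‖Φ v‖) (fun v => norm_nonneg _) h hu he)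
        (le_of_forall_inner_mul_le (N := fun v => ‖Φ v‖) (fun v => norm_nonneg _) h he hu)
      rw [← heq, map_smul, norm_smul, norm_inv, norm_norm]
      field_simp
    · refine ⟨0, fun z => ?_⟩
      have hz : z = 0 := by
        by_contra hz
        have hz0 : ‖z‖ ≠ 0 := norm_ne_zero_iff.2 hz
        exact hex ⟨‖z‖⁻¹ • z, by rw [norm_smul, norm_inv, norm_norm, inv_mul_cancel₀ hz0]⟩
      simp [hz]
  intro x y
  obtain ⟨x, rfl⟩ := hΦ x
  obtain ⟨y, rfl⟩ := hΦ y
  have := parallelogram_law_with_norm ℝ x y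
  rw [← map_add, ← map_sub, hC, hC, hC, hC]
  linear_combination C ^ 2 * this

/-- Auerbach's lemma in dimension three. -/
theorem exists_auerbach [FiniteDimensional ℝ V] (hd : Module.finrank ℝ V = 3) :
    ∃ (e : Fin 3 → V) (f : Fin 3 → V →L[ℝ] ℝ), (∀ i, ‖e i‖ = 1) ∧ (∀ i, f i (e i) = 1) ∧
      (∀ i j, i ≠ j → f i (e j) = 0) ∧ ∀ i w, |f i w| ≤ ‖w‖ := by
  have : ProperSpace V := FiniteDimensional.proper_real V
  let b := Module.finBasisOfFinrankEq ℝ V hd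
  have hcont : Continuous fun v : Fin 3 → V => b.det v := by
    simp only [Module.Basis.det_apply]
    refine Continuous.matrix_det (continuous_matrix fun i j => ?_)
    exact (b.coord i).continuous_of_finiteDimensional.comp (continuous_apply j)
  obtain ⟨e, he, hmax⟩ := (isCompact_closedBall (0 : Fin 3 → V) 1).exists_isMaxOn
    ⟨0, by simp⟩ hcont.continuousOn
  have hel : ∀ i, ‖e i‖ ≤ 1 := fun i => (norm_le_pi_norm e i).trans (by simpa using he)
  set M := b.det e with hM
  have hle : ∀ v : Fin 3 → V, (∀ i, ‖v i‖ ≤ 1) → b.det v ≤ M := fun v hv =>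
    hmax (by rw [mem_closedBall_zero_iff]; exact (pi_norm_le_iff_of_nonneg zero_le_one).2 hv)
  have hMpos : 0 < M := by
    have hb : ∀ i, ‖b i‖ ≠ 0 := fun i => norm_ne_zero_iff.2 (b.ne_zero i)
    have h1 := hle (fun i => ‖b i‖⁻¹ • b i) fun i => by
      rw [norm_smul, norm_inv, norm_norm, inv_mul_cancel₀ (hb i)]
    rw [AlternatingMap.map_smul_univ, b.det_self, smul_eq_mul, mul_one] at h1
    refine lt_of_lt_of_le (Finset.prod_pos fun i _ => ?_) h1
    exact inv_pos.2 (lt_of_le_of_ne (norm_nonneg _) (hb i).symm)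
  -- Cramer's rule gives the dual basis; maximality of the determinant `M` bounds its norms by one.
  let f : Fin 3 → V →L[ℝ] ℝ := fun i =>
    M⁻¹ • LinearMap.toContinuousLinearMap (b.det.toMultilinearMap.toLinearMap e i)
  have hf : ∀ i w, f i w = M⁻¹ * b.det (Function.update e i w) := fun i w => rfl
  have hfle : ∀ i w, f i w ≤ ‖w‖ := by
    intro i w
    rcases eq_or_ne w 0 with rfl | hw
    · simp
    have hw0 : 0 < ‖w‖ := norm_pos_iff.2 hw
    have h1 := hle (Function.update e i (‖w‖⁻¹ • w)) fun j => by
      rcases eq_or_ne j i with rfl | hj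
      · rw [Function.update_self, norm_smul, norm_inv, norm_norm, inv_mul_cancel₀ hw0.ne']
      · rw [Function.update_of_ne hj]; exact hel j
    rw [AlternatingMap.map_update_smul, smul_eq_mul, inv_mul_eq_div, div_le_iff₀ hw0] at h1
    rw [hf, inv_mul_eq_div, div_le_iff₀ hMpos]
    linarith
  have hfabs : ∀ i w, |f i w| ≤ ‖w‖ := fun i w => by
    refine abs_le.2 ⟨?_, hfle i w⟩
    have := hfle i (-w)
    rw [map_neg, norm_neg] at this
    linarith
  have hself : ∀ i, f i (e i) = 1 := fun i => by
    rw [hf, Function.update_eq_self, inv_mul_cancel₀ hMpos.ne']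
  refine ⟨e, f, fun i => le_antisymm (hel i) ?_, hself, fun i j hij => ?_, hfabs⟩
  · rw [← hself i]; exact hfle i _
  · rw [hf, AlternatingMap.map_update_self _ _ hij, mul_zero]

theorem IsPolarField.satisfiesParallelogram [FiniteDimensional ℝ V] (hV : IsRotund V)
    {K : V → V →L[ℝ] ℝ} (hK : IsPolarField K) (hd : Module.finrank ℝ V = 3) :
    SatisfiesParallelogram V := by
  obtain ⟨e, f, he, hfe, hfo, hf⟩ := exists_auerbach hd
  have he0 : ∀ i, e i ≠ 0 := fun i h0 => by simpa [h0] using he i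
  have hKo : ∀ i j, i ≠ j → K (e i) (e j) = 0 := fun i j hij =>
    (hK _ (he0 i)).apply_eq_zero hV (hf j) (by rw [hfe, he]) (hfo j i hij.symm)
  have hframe : IsPolarFrame K (e 0) (e 1) (e 2) :=
    ⟨(hK _ (he0 0)).1, hKo _ _ (by decide), hKo _ _ (by decide), hKo _ _ (by decide),
      (hK _ (he0 1)).1, hKo _ _ (by decide), hKo _ _ (by decide), hKo _ _ (by decide),
      (hK _ (he0 2)).1⟩
  have hspan : ∀ x : V, ∃ α β γ : ℝ, x = α • e 0 + β • e 1 + γ • e 2 := by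
    have hli : LinearIndependent ℝ e := by
      rw [Fintype.linearIndependent_iff]
      intro g hg i
      have := congrArg (f i) hg
      rw [map_sum, Finset.sum_eq_single i] at this
      · simpa [hfe] using this
      · intro j _ hj
        rw [map_smul, hfo i j hj.symm, smul_zero]
      · simp
    intro x
    let b := basisOfLinearIndependentOfCardEqFinrank hli (by rw [hd, Fintype.card_fin])
    refine ⟨b.repr x 0, b.repr x 1, b.repr x 2, ?_⟩
    have := (b.sum_repr x).symm
    rwa [Fin.sum_univ_three, coe_basisOfLinearIndependentOfCardEqFinrank] at this
  obtain ⟨r, s, hr, hs, hdiag⟩ := hframe.exists_diagonal hV hK hd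
  have hr' : √r ≠ 0 := (Real.sqrt_pos.2 hr).ne'
  have hs' : √s ≠ 0 := (Real.sqrt_pos.2 hs).ne'
  -- Rescaling by `√r` and `√s` turns the diagonal form into the standard inner product.
  let Φ : EuclideanSpace ℝ (Fin 3) →ₗ[ℝ] V :=
    { toFun := fun t => (t 0 / √r) • e 0 + (t 1 / √s) • e 1 + t 2 • e 2
      map_add' := fun t t' => by
        simp only [PiLp.add_apply, add_div]
        module
      map_smul' := fun a t => by
        simp only [PiLp.smul_apply, smul_eq_mul, mul_div_assoc, RingHom.id_apply]
        module }
  have hΦ : ∀ t, Φ t = (t 0 / √r) • e 0 + (t 1 / √s) • e 1 + t 2 • e 2 := fun t => rfl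
  refine satisfiesParallelogram_of_inner_le Φ (fun x => ?_) fun v z => ?_
  · obtain ⟨α, β, γ, rfl⟩ := hspan x
    refine ⟨!₂[√r * α, √s * β, γ], ?_⟩
    rw [hΦ]
    simp [hr', hs']
  · rcases eq_or_ne z 0 with rfl | hz
    · simp
    have hz0 : ‖z‖ ≠ 0 := norm_ne_zero_iff.2 hz
    -- Here `l • z` is the orthogonal projection of `v` onto `z`, with remainder `x`. The
    -- contractive projection along `Φ x` sends `Φ v` to `l • Φ z`.
    set l := inner ℝ v z / ‖z‖ ^ 2 with hl
    set x := v - l • z with hx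
    have hxz : inner ℝ x z = 0 := by
      rw [hx, inner_sub_left, inner_smul_left, real_inner_self_eq_norm_sq, RCLike.conj_to_real,
        hl, div_mul_cancel₀ _ (pow_ne_zero 2 hz0), sub_self]
    have hv : Φ v = l • Φ z + Φ x := by rw [hx, map_sub, map_smul]; abel
    have hle : |l| * ‖Φ z‖ ≤ ‖Φ v‖ := by
      rcases eq_or_ne (Φ x) 0 with h0 | h0
      · rw [hv, h0, add_zero, norm_smul, Real.norm_eq_abs]
      obtain ⟨c, hc, c1, c2, c3⟩ := hdiag _ _ _ (hΦ x ▸ h0)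
      rw [← hΦ] at c1 c2 c3
      have hKz : K (Φ x) (Φ z) = 0 := by
        have h1 : c * K (Φ x) (Φ z) = 0 := by
          rw [hΦ z, map_add, map_add, map_smul, map_smul, map_smul, smul_eq_mul, smul_eq_mul,
            smul_eq_mul]
          have h2 : c * (z 0 / √r * K (Φ x) (e 0) + z 1 / √s * K (Φ x) (e 1) +
              z 2 * K (Φ x) (e 2)) = z 0 / √r * (r * (x 0 / √r)) + z 1 / √s * (s * (x 1 / √s))
              + z 2 * x 2 := by
            linear_combination z 0 / √r * c1 + z 1 / √s * c2 + z 2 * c3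
          rw [h2, ← hxz]
          have hr2 := Real.mul_self_sqrt hr.le
          have hs2 := Real.mul_self_sqrt hs.le
          have h3 : z 0 / √r * (r * (x 0 / √r)) = z 0 * x 0 := by
            nth_rewrite 2 [← hr2]; field_simp
          have h4 : z 1 / √s * (s * (x 1 / √s)) = z 1 * x 1 := by
            nth_rewrite 2 [← hs2]; field_simp
          rw [h3, h4]
          simp [PiLp.inner_apply, Fin.sum_univ_three]
        exact (mul_eq_zero.1 h1).resolve_left hc
      have h1 := (hK _ h0).2 (Φ v)
      have h2 : K (Φ x) (Φ v) = 1 := by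
        rw [hv, map_add, map_smul, hKz, smul_zero, zero_add, (hK _ h0).1]
      rwa [h2, one_smul, hv, add_sub_cancel_right, ← hv, norm_smul, Real.norm_eq_abs] at h1
    rw [hl, abs_div, abs_of_nonneg (by positivity : 0 ≤ ‖z‖ ^ 2), div_mul_eq_mul_div,
      div_le_iff₀ (by positivity)] at hle
    exact hle

end Parallelogram

/-! ### The plane: an invariant quadratic form of maximal determinant -/

section Plane

variable {X : Type*} [NormedAddCommGroup X] [NormedSpace ℝ X]

/-- The quadratic form with coefficients `w` in the coordinates `p`, `r`. -/
def planeForm (p r : X →L[ℝ] ℝ) (w : ℝ × ℝ × ℝ) (x : X) : ℝ :=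
  w.1 * p x ^ 2 + 2 * w.2.1 * (p x * r x) + w.2.2 * r x ^ 2

/-- The discriminant of a binary quadratic form. -/
def planeDet (w : ℝ × ℝ × ℝ) : ℝ := w.1 * w.2.2 - w.2.1 ^ 2

/-- Coefficients of the positive semidefinite forms bounded by the square of the norm. -/
def planeForms (p r : X →L[ℝ] ℝ) : Set (ℝ × ℝ × ℝ) :=
  {w | ∀ x, 0 ≤ planeForm p r w x ∧ planeForm p r w x ≤ ‖x‖ ^ 2}

variable {p r : X →L[ℝ] ℝ} {u v : X}

theorem isCompact_planeForms (hpu : p u = 1) (hpv : p v = 0) (hru : r u = 0) (hrv : r v = 1) :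
    IsCompact (planeForms p r) := by
  refine Metric.isCompact_of_isClosed_isBounded ?_ ?_
  · have : planeForms p r = ⋂ x, {w | 0 ≤ planeForm p r w x ∧ planeForm p r w x ≤ ‖x‖ ^ 2} := by
      ext w; simp [planeForms]
    rw [this]
    refine isClosed_iInter fun x => ?_
    have hc : Continuous fun w => planeForm p r w x := by unfold planeForm; fun_prop
    exact (isClosed_le continuous_const hc).inter (isClosed_le hc continuous_const)
  · refine (Metric.isBounded_closedBall
      (x := (0 : ℝ × ℝ × ℝ)) (r := ‖u‖ ^ 2 + ‖v‖ ^ 2 + ‖u + v‖ ^ 2)).subset fun w hw => ?_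
    obtain ⟨A, B, C⟩ := w
    have h1 := hw u
    have h2 := hw v
    have h3 := hw (u + v)
    simp only [planeForm, hpu, hpv, hru, hrv, map_add] at h1 h2 h3
    have k1 := sq_nonneg ‖u‖
    have k2 := sq_nonneg ‖v‖
    have k3 := sq_nonneg ‖u + v‖
    rw [mem_closedBall_zero_iff, Prod.norm_def, Prod.norm_def]
    simp only [Real.norm_eq_abs]
    refine max_le ?_ (max_le ?_ ?_) <;> rw [abs_le] <;> constructor <;> nlinarith

/-- Coefficients of the form composed with a linear map of matrix `(a b; c d)`. -/
def planePullback (a b c d : ℝ) (w : ℝ × ℝ × ℝ) : ℝ × ℝ × ℝ :=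
  (w.1 * a ^ 2 + 2 * w.2.1 * (a * b) + w.2.2 * b ^ 2,
    w.1 * (a * c) + w.2.1 * (a * d + b * c) + w.2.2 * (b * d),
    w.1 * c ^ 2 + 2 * w.2.1 * (c * d) + w.2.2 * d ^ 2)

theorem planeDet_pullback (a b c d : ℝ) (w : ℝ × ℝ × ℝ) :
    planeDet (planePullback a b c d w) = planeDet w * (a * d - b * c) ^ 2 := by
  simp only [planeDet, planePullback]; ring

theorem planeForm_pullback (hspan : ∀ x, x = p x • u + r x • v) (T : X →ₗ[ℝ] X)
    (w : ℝ × ℝ × ℝ) (x : X) :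
    planeForm p r (planePullback (p (T u)) (r (T u)) (p (T v)) (r (T v)) w) x =
      planeForm p r w (T x) := by
  have h1 : p (T x) = p x * p (T u) + r x * p (T v) := by
    conv_lhs => rw [hspan x]
    simp
  have h2 : r (T x) = p x * r (T u) + r x * r (T v) := by
    conv_lhs => rw [hspan x]
    simp
  simp only [planeForm, planePullback, h1, h2]
  ring

/-- Strict log-concavity of the determinant on positive definite forms, which makes the maximiser
unique. -/
theorem eq_of_planeDet_le {w w' : ℝ × ℝ × ℝ} {M : ℝ} (hM : 0 < M) (hw : planeDet w = M)
    (hw' : planeDet w' = M) (h1 : 0 ≤ w.1) (h1' : 0 ≤ w'.1)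
    (hmid : planeDet ((1 / 2 : ℝ) • w + (1 / 2 : ℝ) • w') ≤ M) : w = w' := by
  obtain ⟨A, B, C⟩ := w
  obtain ⟨A', B', C'⟩ := w'
  simp only [planeDet, Prod.smul_mk, Prod.mk_add_mk, smul_eq_mul] at *
  have hA : 0 < A := lt_of_le_of_ne h1 (by rintro rfl; nlinarith)
  have hA' : 0 < A' := lt_of_le_of_ne h1' (by rintro rfl; nlinarith)
  have k1 : A * C' + A' * C - 2 * (B * B') ≤ 2 * M := by nlinarith
  -- Multiply `k1` by `A * A'` and eliminate `C`, `C'` through `A C = M + B²` and `A' C' = M + B'²`.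
  have k2 : M * (A - A') ^ 2 + (A * B' - A' * B) ^ 2 ≤ 0 := by
    have k3 : A * A' * (A * C' + A' * C - 2 * (B * B')) ≤ A * A' * (2 * M) := by gcongr
    have k4 : A * A' * (A * C' + A' * C - 2 * (B * B')) =
        A ^ 2 * (M + B' ^ 2) + A' ^ 2 * (M + B ^ 2) - 2 * (A * A' * (B * B')) := by
      linear_combination A ^ 2 * hw' + A' ^ 2 * hw
    nlinarith
  have k5 : A = A' := by
    have : (A - A') ^ 2 = 0 := by
      refine le_antisymm ?_ (sq_nonneg _)
      by_contra hcon
      nlinarith [mul_pos hM (not_le.1 hcon), sq_nonneg (A * B' - A' * B)]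
    exact sub_eq_zero.1 (pow_eq_zero_iff two_ne_zero |>.1 this)
  subst k5
  have k6 : B = B' := by
    have : (A * B' - A * B) ^ 2 = 0 := by
      refine le_antisymm ?_ (sq_nonneg _)
      nlinarith
    have := pow_eq_zero_iff two_ne_zero |>.1 this
    rw [← mul_sub] at this
    linarith [(mul_eq_zero.1 this).resolve_left hA.ne']
  subst k6
  have k7 : C = C' := mul_left_cancel₀ hA.ne' (by linarith)
  rw [k7]

/-- In the plane, some positive definite quadratic form is invariant under all isometries. -/
theorem exists_invariant_planeForm (hpu : p u = 1) (hpv : p v = 0) (hru : r u = 0) (hrv : r v = 1)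
    (hspan : ∀ x, x = p x • u + r x • v) :
    ∃ w : ℝ × ℝ × ℝ, 0 < planeForm p r w u ∧
      ∀ (T : X ≃ₗᵢ[ℝ] X) (x : X), planeForm p r w (T x) = planeForm p r w x := by
  have hcont : Continuous planeDet := by unfold planeDet; fun_prop
  set κ := (‖p‖ ^ 2 + ‖r‖ ^ 2 + 1)⁻¹ with hκ
  have hκ0 : 0 < κ := by positivity
  have hmem : ((κ, 0, κ) : ℝ × ℝ × ℝ) ∈ planeForms p r := by
    intro x
    have hp : p x ^ 2 ≤ (‖p‖ * ‖x‖) ^ 2 := sq_le_sq' (abs_le.1 (p.le_opNorm x)).1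
      (abs_le.1 (p.le_opNorm x)).2
    have hr : r x ^ 2 ≤ (‖r‖ * ‖x‖) ^ 2 := sq_le_sq' (abs_le.1 (r.le_opNorm x)).1
      (abs_le.1 (r.le_opNorm x)).2
    have heq : planeForm p r (κ, 0, κ) x = κ * (p x ^ 2 + r x ^ 2) := by
      simp only [planeForm]; ring
    rw [heq]
    refine ⟨by positivity, ?_⟩
    rw [hκ, inv_mul_eq_div, div_le_iff₀ (by positivity)]
    nlinarith [sq_nonneg ‖x‖]
  obtain ⟨w, hw, hmax⟩ := (isCompact_planeForms hpu hpv hru hrv).exists_isMaxOn ⟨_, hmem⟩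
    hcont.continuousOn
  have hmax' : ∀ w' ∈ planeForms p r, planeDet w' ≤ planeDet w := fun w' h => hmax h
  have hM : 0 < planeDet w := lt_of_lt_of_le (by simp only [planeDet]; nlinarith)
    (hmax' _ hmem)
  have hfst : ∀ w, planeForm p r w u = w.1 := fun w => by simp [planeForm, hpu, hru]
  have hpull : ∀ T : X ≃ₗᵢ[ℝ] X,
      planePullback (p (T u)) (r (T u)) (p (T v)) (r (T v)) w ∈ planeForms p r := fun T x => by
    have := hw (T x)
    rw [T.norm_map] at this
    exact (planeForm_pullback hspan T.toLinearEquiv.toLinearMap w x).symm ▸ this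
  have hdet : ∀ T : X ≃ₗᵢ[ℝ] X, (p (T u) * r (T v) - r (T u) * p (T v)) ^ 2 ≤ 1 := fun T => by
    have := hmax' _ (hpull T)
    rw [planeDet_pullback] at this
    by_contra hcon
    nlinarith
  -- Maximality bounds the squared determinants of both `T` and `T.symm` by one, and their product
  -- is one.
  have hdet1 : ∀ T : X ≃ₗᵢ[ℝ] X, (p (T u) * r (T v) - r (T u) * p (T v)) ^ 2 = 1 := fun T => by
    have key : ∀ (f : X →L[ℝ] ℝ) (x : X),
        p (T.symm x) * f (T u) + r (T.symm x) * f (T v) = f x := by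
      intro f x
      have h1 : T (T.symm x) = x := T.apply_symm_apply x
      rw [hspan (T.symm x), map_add, map_smul, map_smul] at h1
      conv_rhs => rw [← h1]
      simp
    have h1 := key p u
    have h2 := key r u
    have h3 := key p v
    have h4 := key r v
    rw [hpu] at h1
    rw [hru] at h2
    rw [hpv] at h3
    rw [hrv] at h4
    have hprod : (p (T u) * r (T v) - r (T u) * p (T v)) *
        (p (T.symm u) * r (T.symm v) - r (T.symm u) * p (T.symm v)) = 1 := by
      linear_combination (p (T.symm v) * r (T u) + r (T.symm v) * r (T v)) * h1 + h4 -
        (p (T.symm v) * p (T u) + r (T.symm v) * p (T v)) * h2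
    have hsq := congrArg (· ^ 2) hprod
    simp only [mul_pow, one_pow] at hsq
    have ha := hdet T
    have hb := hdet T.symm
    refine le_antisymm ha ?_
    nlinarith [sq_nonneg (p (T u) * r (T v) - r (T u) * p (T v))]
  refine ⟨w, ?_, fun T x => ?_⟩
  · rw [hfst]
    refine lt_of_le_of_ne (hfst w ▸ (hw u).1) fun h0 => ?_
    rw [planeDet, ← h0] at hM
    nlinarith [sq_nonneg w.2.1]
  · have heq : w = planePullback (p (T u)) (r (T u)) (p (T v)) (r (T v)) w := by
      refine eq_of_planeDet_le hM rfl ?_ (hfst w ▸ (hw u).1) (hfst _ ▸ (hpull T u).1) ?_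
      · rw [planeDet_pullback, hdet1, mul_one]
      · refine hmax' _ fun x => ?_
        have hlin : ∀ w w' : ℝ × ℝ × ℝ, planeForm p r ((1 / 2 : ℝ) • w + (1 / 2 : ℝ) • w') x =
            (planeForm p r w x + planeForm p r w' x) / 2 := fun w w' => by
          simp only [planeForm, Prod.fst_add, Prod.snd_add, Prod.smul_fst, Prod.smul_snd,
            smul_eq_mul]
          ring
        rw [hlin]
        have a := hw x
        have b := hpull T x
        constructor <;> linarith
    conv_rhs => rw [heq]
    exact (planeForm_pullback hspan T.toLinearEquiv.toLinearMap w x).symm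

theorem IsWeaklyLUR.satisfiesParallelogram_of_plane (hX : IsWeaklyLUR X)
    (hbig : ∃ u : X, IsBigPoint u) (hd : Module.finrank ℝ X = 2) : SatisfiesParallelogram X := by
  obtain ⟨e, he⟩ := hbig
  have : FiniteDimensional ℝ X := Module.finite_of_finrank_pos (by omega)
  let b := Module.finBasisOfFinrankEq ℝ X hd
  let p : X →L[ℝ] ℝ := LinearMap.toContinuousLinearMap (b.coord 0)
  let r : X →L[ℝ] ℝ := LinearMap.toContinuousLinearMap (b.coord 1)
  obtain ⟨w, hw, hinv⟩ := exists_invariant_planeForm (p := p) (r := r) (u := b 0) (v := b 1)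
    (by simp [p]) (by simp [p]) (by simp [r]) (by simp [r]) (fun x => by
      have := (b.sum_repr x).symm
      rwa [Fin.sum_univ_two] at this)
  -- Rotations bring `x` weakly to `e`; the form is invariant and depends on just two functionals,
  -- so weak convergence suffices.
  have hunit : ∀ x : X, ‖x‖ = 1 → planeForm p r w x = planeForm p r w e := by
    intro x hx
    obtain ⟨T, -, hT⟩ := hX.exists_rotations he he.1 hx
    have hlim : Tendsto (fun n => planeForm p r w ((T n).symm x)) atTop
        (𝓝 (planeForm p r w e)) :=
      (((hT p).pow 2).const_mul _).add (((hT p).mul (hT r)).const_mul _) |>.add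
        (((hT r).pow 2).const_mul _)
    simp only [hinv] at hlim
    exact tendsto_nhds_unique tendsto_const_nhds hlim
  have hall : ∀ x : X, planeForm p r w x = planeForm p r w e * (‖x‖ * ‖x‖) := by
    intro x
    rcases eq_or_ne x 0 with rfl | hx
    · simp [planeForm]
    have hx0 : ‖x‖ ≠ 0 := norm_ne_zero_iff.2 hx
    rw [← hunit (‖x‖⁻¹ • x) (by rw [norm_smul, norm_inv, norm_norm, inv_mul_cancel₀ hx0])]
    simp only [planeForm, map_smul, smul_eq_mul]
    field_simp
  have hne : planeForm p r w e ≠ 0 := fun h0 => by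
    rw [hall, h0, zero_mul] at hw
    exact lt_irrefl _ hw
  intro x y
  apply mul_left_cancel₀ hne
  have h1 := hall (x + y)
  have h2 := hall (x - y)
  have h3 := hall x
  have h4 := hall y
  have h5 : planeForm p r w (x + y) + planeForm p r w (x - y) =
      2 * (planeForm p r w x + planeForm p r w y) := by
    simp only [planeForm, map_add, map_sub]; ring
  linear_combination h5 - h1 - h2 + 2 * h3 + 2 * h4

end Plane

/-! ### Assembling the parallelogram law -/

section Main

variable {X : Type*} [NormedAddCommGroup X] [NormedSpace ℝ X]

theorem satisfiesParallelogram_of_isPolar (hX : IsRotund X)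
    (hpol : ∀ x : X, x ≠ 0 → ∃ k : X →L[ℝ] ℝ, IsPolar x k) {V : Submodule ℝ X}
    (hd : Module.finrank ℝ V = 3) : SatisfiesParallelogram V := by
  have : FiniteDimensional ℝ V := Module.finite_of_finrank_pos (by omega)
  have hV : IsRotund V := fun x y hx hy hxy => Subtype.ext (hX x y hx hy hxy)
  have h : ∀ x : V, ∃ k : V →L[ℝ] ℝ, x ≠ 0 → IsPolar x k := by
    intro x
    by_cases hx : x = 0
    · exact ⟨0, fun h => absurd hx h⟩
    obtain ⟨k, hk⟩ := hpol x (by simpa using hx)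
    exact ⟨k.comp V.subtypeL, fun _ => ⟨hk.1, fun y => hk.2 y⟩⟩
  choose K hK using h
  exact IsPolarField.satisfiesParallelogram hV hK hd

theorem IsWeaklyLUR.satisfiesParallelogram (hLUR : IsWeaklyLUR X)
    (hbig : ∃ u : X, IsBigPoint u)
    (hcompl : ∀ ε : ℝ, 0 < ε → ∃ Z : Submodule ℝ X,
      Module.finrank ℝ (X ⧸ Z) = 1 ∧ IsComplementedWithConst (1 + ε) Z) :
    SatisfiesParallelogram X := by
  intro x y
  by_cases hli : LinearIndependent ℝ ![x, y]
  · by_cases htop : Submodule.span ℝ (Set.range ![x, y]) = ⊤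
    · refine hLUR.satisfiesParallelogram_of_plane hbig ?_ x y
      rw [← finrank_top ℝ X, ← htop, finrank_span_eq_card hli, Fintype.card_fin]
    -- There is room for a third vector, so the pair lies in a three-dimensional subspace.
    · obtain ⟨z, -, hz⟩ := SetLike.exists_of_lt (lt_top_iff_ne_top.2 htop)
      have hli3 : LinearIndependent ℝ (Fin.cons z ![x, y] : Fin 3 → X) :=
        linearIndependent_finCons.2 ⟨hli, hz⟩
      have hd : Module.finrank ℝ (Submodule.span ℝ (Set.range (Fin.cons z ![x, y] : Fin 3 → X)))
          = 3 := by
        rw [finrank_span_eq_card hli3, Fintype.card_fin]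
      exact satisfiesParallelogram_of_isPolar hLUR.isRotund
        (fun x hx => hLUR.exists_isPolar hbig hcompl hx) hd
        ⟨x, Submodule.subset_span ⟨1, rfl⟩⟩ ⟨y, Submodule.subset_span ⟨2, rfl⟩⟩
  · rcases eq_or_ne x 0 with rfl | hx
    · simp; ring
    · rw [LinearIndependent.pair_iff' hx] at hli
      push Not at hli
      obtain ⟨a, rfl⟩ := hli
      have h1 : x + a • x = (1 + a) • x := by module
      have h2 : x - a • x = (1 - a) • x := by module
      rw [h1, h2, norm_smul, norm_smul, norm_smul]
      simp only [Real.norm_eq_abs]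
      have e1 := abs_mul_abs_self (1 + a)
      have e2 := abs_mul_abs_self (1 - a)
      have e3 := abs_mul_abs_self a
      linear_combination (‖x‖ * ‖x‖) * (e1 + e2 - 2 * e3)

end Main

theorem theorem3p3 {X : Type*} [NormedAddCommGroup X] [NormedSpace ℝ X] [CompleteSpace X]
    (hLUR : IsWeaklyLUR X)
    (hbig : ∃ u : X, IsBigPoint u)
    (hcompl : ∀ ε : ℝ, 0 < ε → ∃ Z : Submodule ℝ X,
      Module.finrank ℝ (X ⧸ Z) = 1 ∧ IsComplementedWithConst (1 + ε) Z) :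
    IsIsometricallyHilbert X :=
  ⟨X, inferInstance, InnerProductSpace.ofNorm ℝ (hLUR.satisfiesParallelogram hbig hcompl),
    inferInstance, ⟨LinearIsometryEquiv.refl ℝ X⟩⟩
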